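/- Let $c=\alpha+\beta i\in\mathbb C$ with $|c|>1$ and $\beta>0$, and let $f:\mathbb C\to\mathbb C$ be the twisted tent map with $f(z)=cz$ if $\operatorname{Im}(cz)\ge -1$ and $f(z)=\overline{cz}-2i$ otherwise. Let $K$ be the set of points with bounded trajectory under $f$. Put $\mathrm{FL}=\{z:\operatorname{Im} z=-1\}$, $\mathrm{PFL}=f^{-1}(\mathrm{FL})$, $P\mathbb H^+=\{z: f(z)=cz\}$, let $z'=\frac1c(\overline{cz}-2i)$ be the mirror image of $z$ in the line $\mathrm{PFL}$, and let $\gamma_0$ be the point of $\mathrm{FL}\cap\mathrm{PFL}$. Let $\ell_0=\frac{2i(1-\overline c)}{|c|^2-1}$, $\ell_k=\ell_0/c^k$ for $k>0$, $\ell_k=(\ell_{1-k})'$ for $k<0$, $L_k=[\ell_k,\ell_{k+1}]$ for $k\in\mathbb Z$, and $m_k=\frac{\ell_k+\ell_{k+1}}2$. The line $\mathrm{PFL}$ is the perpendicular bisector of $L_0$. Let $M_0=\{m_0-t/c:t\ge 0\}$ (the half of $\mathrm{PFL}$ starting at $m_0$ and leaving $L_0$ on the side opposite to the origin) and $M_1=\{m_1-t/c^2:t\ge0\}=M_0/c$.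 The curve $M_0\cup[m_0,\ell_1]\cup[\ell_1,m_1]\cup M_1$ cuts the plane into two regions; let $S_1$ be the closed one that does not contain $0$. Let $S_k=\frac{S_{k-1}}c\cap P\mathbb H^+$ for $k\ge2$, $S=\bigcup_{k\ge1}S_k$, $S'=\{z':z\in S\}$, and let $P=\mathbb C\setminus\operatorname{Int}(S\cup S')$ be the perimeter set. Suppose that $L_j\cap\mathrm{PFL}\ne\emptyset$ for some $j\geq 1$, let $n$ be the smallest such $j$, and let $\zeta$ be the point with $L_n\cap\mathrm{PFL}=\{\zeta\}$. The outer-most boundary of $P$ is then the closed polygonal curve $$[\ell_n,\zeta]\cup[\ell_{-(n-1)},\zeta]\cup\bigcup_{|k|\le n-1}L_k .$$ Theorem. If $\operatorname{Im}(\zeta)>-1$, then 1. $\gamma_0\notin K$; 2. $P$ is not the polygon bounded by the outer-most boundary of $P$ (the closed region consisting of this curve and all bounded components of its complement); 3. $K\subsetneq P$. -/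

import Mathlib

noncomputable section

namespace TwistedTent

open Complex Set

/-- The folding line. -/
def FL : Set ℂ := {z | z.im = -1}

/-- Reflection about the folding line. -/
def reflectFL (z : ℂ) : ℂ := (starRingEnd ℂ) z - 2 * I

/-- The twisted tent map with parameter `c`: multiply by `c`, then fold the half plane below
the folding line onto the half plane above it. -/
def f (c z : ℂ) : ℂ := if -1 ≤ (c * z).im then c * z else reflectFL (c * z)

/-- The filled-in Julia set: the points with bounded trajectory. -/
def K (c : ℂ) : Set ℂ := {z | Bornology.IsBounded (range fun n : ℕ => (f c)^[n] z)}

/-- The pre-folding line. -/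
def PFL (c : ℂ) : Set ℂ := f c ⁻¹' FL

/-- The pre-upper half plane. -/
def PHPlus (c : ℂ) : Set ℂ := {z | f c z = c * z}

/-- Reflection about the pre-folding line, `z ↦ z'`. -/
def reflectPFL (c z : ℂ) : ℂ := reflectFL (c * z) / c

/-- The intersection point of the folding line and the pre-folding line
(see `FL_inter_PFL` below). -/
def gamma0 (c : ℂ) : ℂ := (((c.re - 1) / c.im : ℝ) : ℂ) - I

/-- The nonzero fixed point of `f c`. -/
def ell0 (c : ℂ) : ℂ := 2 * I * (1 - (starRingEnd ℂ) c) / ((‖c‖ : ℂ) ^ 2 - 1)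

/-- The points `ℓ_k`, `k ∈ ℤ`: `ℓ_k = ℓ_0 / c ^ k` for `k ≥ 0`, and for `k < 0` the point `ℓ_k`
is the mirror image of `ℓ_{1 - k}` in the pre-folding line. -/
def ell (c : ℂ) (k : ℤ) : ℂ :=
  if 0 ≤ k then ell0 c / c ^ k else reflectPFL c (ell0 c / c ^ (1 - k))

/-- The line segments `L_j = [ℓ_j, ℓ_{j+1}]`. -/
def L (c : ℂ) (j : ℤ) : Set ℂ := segment ℝ (ell c j) (ell c (j + 1))

/-- The midpoint `m_k` of `L_k`. -/
def mid (c : ℂ) (k : ℤ) : ℂ := (ell c k + ell c (k + 1)) / 2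

/-- The four sides of the region `S_1`: the two segments `[m_0, ℓ_1]` and `[ℓ_1, m_1]`, the half
of the pre-folding line that starts at `m_0` and points away from the origin side of `L_0`, and
the half of `PFL / c` that starts at `m_1` and points away from the origin side of `L_1`.
(The pre-folding line is the perpendicular bisector of `L_0`; it has direction `1 / c`.) -/
def sides (c : ℂ) : Set ℂ :=
  {z | ∃ t : ℝ, 0 ≤ t ∧ z = mid c 0 - t / c} ∪ segment ℝ (mid c 0) (ell c 1) ∪
    segment ℝ (ell c 1) (mid c 1) ∪ {z | ∃ t : ℝ, 0 ≤ t ∧ z = mid c 1 - t / c ^ 2}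

/-- The four sides cut the plane into an inner region, which contains the origin, and an outer
region. `S_1` is the closed outer region. (`S1_eq` below describes it by inequalities.) -/
def S1 (c : ℂ) : Set ℂ := closure (sides c ∪ connectedComponentIn (sides c)ᶜ 0)ᶜ

/-- `SSeq c k` is the set `S_{k+1}`: `S_{k+1} = (S_k / c) ∩ PH⁺` for `k ≥ 1`. -/
def SSeq (c : ℂ) : ℕ → Set ℂ
  | 0 => S1 c
  | k + 1 => (fun z => z / c) '' SSeq c k ∩ PHPlus c

/-- `S = S_1 ∪ S_2 ∪ ⋯`. -/
def S (c : ℂ) : Set ℂ := ⋃ k : ℕ, SSeq c k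

/-- The perimeter set. -/
def P (c : ℂ) : Set ℂ := (interior (S c ∪ reflectPFL c '' S c))ᶜ

/-- `n` is the smallest positive integer such that `L_n` meets the pre-folding line, and `ζ` is
the point of intersection. (So "`ζ` exists" means that there are such `n` and `ζ`.) -/
def IsZeta (c : ℂ) (n : ℤ) (ζ : ℂ) : Prop :=
  IsLeast {j : ℤ | 0 < j ∧ (L c j ∩ PFL c).Nonempty} n ∧ L c n ∩ PFL c = {ζ}

/-- The outer-most boundary of `P` when `ζ` exists and lies on `L_n`. -/
def outerBoundary (c : ℂ) (n : ℤ) (ζ : ℂ) : Set ℂ :=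
  segment ℝ (ell c n) ζ ∪ segment ℝ (ell c (-(n - 1))) ζ ∪ ⋃ k ∈ {k : ℤ | |k| ≤ n - 1}, L c k

/-- The closed region bounded by a closed curve `Γ` in the plane: `Γ` together with all bounded
components of its complement. -/
def regionBoundedBy (Γ : Set ℂ) : Set ℂ :=
  Γ ∪ {z | z ∉ Γ ∧ Bornology.IsBounded (connectedComponentIn Γᶜ z)}

lemma FL_inter_PFL (c : ℂ) (hβ : 0 < c.im) : FL ∩ PFL c = {gamma0 c} := by
  have key : ∀ z : ℂ, (f c z).im = -1 ↔ (c * z).im = -1 := by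
    intro z
    unfold f reflectFL
    split_ifs with h
    · rfl
    · simp only [sub_im, conj_im, mul_im, re_ofNat, I_im, im_ofNat, I_re] at *
      constructor <;> intro h' <;> linarith
  ext z
  simp only [mem_inter_iff, FL, PFL, mem_preimage, mem_ofPred_eq, key, mem_singleton_iff, gamma0,
    Complex.ext_iff, mul_im, sub_re, sub_im, ofReal_re, ofReal_im, I_re, I_im]
  constructor
  · rintro ⟨h1, h2⟩
    refine ⟨?_, by linarith⟩
    rw [h1] at h2
    field_simp
    linarith
  · rintro ⟨h1, h2⟩
    have h3 : z.im = -1 := by linarith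
    refine ⟨h3, ?_⟩
    rw [h1, h3]
    field_simp
    ring


set_option maxHeartbeats 2000000 in
/-- `S_1` in explicit form. -/
lemma S1_eq (c : ℂ) (hc : 1 < ‖c‖) (hβ : 0 < c.im) :
    S1 c = {z | ((c * z).re ≤ (ell0 c).re ∧ -1 ≤ (c * z).im ∧ (c * z).im ≤ (ell0 c).im) ∨
      ((ell0 c).im ≤ (c * z).im ∧ (c ^ 2 * z).im ≤ (c * ell0 c).im) ∨
      ((c ^ 2 * z).re ≤ (ell0 c).re ∧ (c * ell0 c).im ≤ (c ^ 2 * z).im ∧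
        (c ^ 2 * z).im ≤ -1)} := by
  have hc0 : c ≠ 0 := by
    rintro rfl
    simp at hβ
  have hn : (0 : ℝ) < c.re * c.re + c.im * c.im := by nlinarith [mul_pos hβ hβ, mul_self_nonneg c.re]
  have hd : (0 : ℝ) < c.re * c.re + c.im * c.im - 1 := by
    have h1 : ‖c‖ ^ 2 = c.re * c.re + c.im * c.im := by
      rw [← Complex.normSq_eq_norm_sq, Complex.normSq_apply]
    nlinarith
  have hdne := hd.ne'
  have hD : ((‖c‖ : ℂ) ^ 2 - 1) = ((c.re * c.re + c.im * c.im - 1 : ℝ) : ℂ) := by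
    rw [← Complex.normSq_apply, Complex.normSq_eq_norm_sq]
    push_cast
    rfl
  have hre : (ell0 c).re = -2 * c.im / (c.re * c.re + c.im * c.im - 1) := by
    rw [ell0, hD, div_ofReal_re]
    simp
  have him : (ell0 c).im = 2 * (1 - c.re) / (c.re * c.re + c.im * c.im - 1) := by
    rw [ell0, hD, div_ofReal_im]
    simp
  have hre' : (c * ell0 c).re = (ell0 c).re := by
    rw [mul_re, hre, him]
    field_simp
    ring
  have him' : (c * ell0 c).im = -(ell0 c).im - 2 := by
    have hk : (c.re * c.re + c.im * c.im - 1) * (c.re * c.re + c.im * c.im - 1)⁻¹ = 1 :=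
      mul_inv_cancel₀ hdne
    rw [mul_im, hre, him, div_eq_mul_inv, div_eq_mul_inv]
    linear_combination (-2) * hk
  have hre0 : (ell0 c).re < 0 := by
    rw [hre]
    exact div_neg_of_neg_of_pos (by linarith) hd
  have hh : 0 < (ell0 c).im + 1 := by
    rw [him, div_add_one hd.ne']
    apply div_pos _ hd
    nlinarith [sq_nonneg (c.re - 1)]
  generalize hw : ell0 c = w at *
  obtain ⟨h, hhd⟩ : ∃ h, h = w.im + 1 := ⟨_, rfl⟩
  -- coordinates
  obtain ⟨X, hX⟩ : ∃ X : ℂ → ℝ, ∀ z, X z = (c * z).re - w.re := ⟨_, fun _ => rfl⟩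
  obtain ⟨Y, hY⟩ : ∃ Y : ℂ → ℝ, ∀ z, Y z = (c * z).im - w.im := ⟨_, fun _ => rfl⟩
  obtain ⟨p, hp⟩ : ∃ p : ℂ → ℝ, ∀ z, p z = (c ^ 2 * z).re - w.re := ⟨_, fun _ => rfl⟩
  obtain ⟨q, hq⟩ : ∃ q : ℂ → ℝ, ∀ z, q z = (c ^ 2 * z).im - (c * w).im := ⟨_, fun _ => rfl⟩
  have hpe : ∀ z, p z = c.re * X z - c.im * Y z := by
    intro z
    have : w.re = c.re * w.re - c.im * w.im := by rw [← mul_re, hre']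
    rw [hp, hX, hY, sq, mul_assoc, mul_re c (c * z)]
    linarith
  have hqe : ∀ z, q z = c.re * Y z + c.im * X z := by
    intro z
    rw [hq, hX, hY, sq, mul_assoc, mul_im c (c * z), mul_im c w]
    ring
  have hsurj : ∀ a b : ℝ, ∃ z, X z = a ∧ Y z = b := by
    intro a b
    refine ⟨(w + (⟨a, b⟩ : ℂ)) / c, ?_, ?_⟩
    · rw [hX, mul_div_cancel₀ _ hc0]
      simp
    · rw [hY, mul_div_cancel₀ _ hc0]
      simp
  have hinj : ∀ z z', X z = X z' → Y z = Y z' → z = z' := by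
    intro z z' h1 h2
    apply mul_left_cancel₀ hc0
    rw [hX, hX] at h1
    rw [hY, hY] at h2
    apply Complex.ext <;> linarith
  have hXc : Continuous X := by
    rw [funext hX]
    fun_prop
  have hYc : Continuous Y := by
    rw [funext hY]
    fun_prop
  have hpc : Continuous p := by
    rw [funext hp]
    fun_prop
  have hqc : Continuous q := by
    rw [funext hq]
    fun_prop
  have hXa : ∀ (s t : ℝ) (z z' : ℂ), s + t = 1 → X (s • z + t • z') = s * X z + t * X z' := by
    intro s t z z' hst
    simp only [hX, mul_re, add_re, add_im, real_smul, ofReal_re, ofReal_im, mul_im]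
    linear_combination w.re * hst
  have hYa : ∀ (s t : ℝ) (z z' : ℂ), s + t = 1 → Y (s • z + t • z') = s * Y z + t * Y z' := by
    intro s t z z' hst
    simp only [hY, mul_re, add_re, add_im, real_smul, ofReal_re, ofReal_im, mul_im]
    linear_combination w.im * hst
  have hpa : ∀ (s t : ℝ) (z z' : ℂ), s + t = 1 → p (s • z + t • z') = s * p z + t * p z' := by
    intro s t z z' hst
    simp only [hpe, hXa s t z z' hst, hYa s t z z' hst]
    ring
  have hqa : ∀ (s t : ℝ) (z z' : ℂ), s + t = 1 → q (s • z + t • z') = s * q z + t * q z' := by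
    intro s t z z' hst
    simp only [hqe, hXa s t z z' hst, hYa s t z z' hst]
    ring
  -- convex sets defined by one or two of the coordinates
  have cvx : ∀ F : ℂ → ℝ,
      (∀ (s t : ℝ) (z z' : ℂ), s + t = 1 → F (s • z + t • z') = s * F z + t * F z') →
      ∀ T : Set ℝ, Convex ℝ T → Convex ℝ (F ⁻¹' T) := by
    intro F hF T hT z hz z' hz' s t hs ht hst
    rw [mem_preimage, hF s t z z' hst]
    exact hT hz hz' hs ht hst
  have hhp : 0 < h := by linarith
  -- relations between the coordinates
  have r1 : ∀ z, c.re * p z + c.im * q z = (c.re * c.re + c.im * c.im) * X z := by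
    intro z
    rw [hpe, hqe]
    ring
  have r2 : ∀ z, c.re * q z - c.im * p z = (c.re * c.re + c.im * c.im) * Y z := by
    intro z
    rw [hpe, hqe]
    ring
  have hinj2 : ∀ z z', p z = p z' → q z = q z' → z = z' := by
    intro z z' h1 h2
    have e1 := r1 z
    have e2 := r2 z
    rw [h1, h2] at e1 e2
    rw [r1] at e1
    rw [r2] at e2
    exact hinj _ _ (mul_left_cancel₀ hn.ne' e1.symm) (mul_left_cancel₀ hn.ne' e2.symm)
  have hnα : 0 < c.re * c.re + c.im * c.im + c.re := by
    by_cases h1 : -1 ≤ c.re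
    · linarith
    · nlinarith [mul_pos hβ hβ]
  have k1 : ∀ z, p z ≤ 0 → 0 ≤ q z → q z ≤ h → -h < Y z := by
    intro z h1 h2 h3
    have e := r2 z
    have e1 : 0 ≤ c.im * -p z := mul_nonneg hβ.le (by linarith)
    by_contra hcon
    have e2 := mul_le_mul_of_nonneg_left (not_lt.1 hcon) hn.le
    have e3 := mul_pos hnα hhp
    by_cases hα : 0 ≤ c.re
    · have e4 := mul_nonneg hα h2
      have e5 := mul_pos hn hhp
      linarith
    · have e4 := mul_nonneg (neg_nonneg.2 (not_le.1 hα).le) (sub_nonneg.2 h3)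
      linarith
  have k2 : ∀ z, p z ≤ 0 → 0 < q z → Y z ≤ 0 → 0 < X z := by
    intro z h1 h2 h3
    have e := r2 z
    have e0 := r1 z
    have e1 : 0 ≤ c.im * -p z := mul_nonneg hβ.le (by linarith)
    have e2 := mul_nonneg hn.le (neg_nonneg.2 h3)
    have hα : c.re ≤ 0 := by
      by_contra hcon
      have := mul_pos (not_le.1 hcon) h2
      linarith
    have e3 := mul_nonneg (neg_nonneg.2 hα) (neg_nonneg.2 h1)
    have e4 := mul_pos hβ h2
    by_contra hcon
    have e5 := mul_nonneg hn.le (neg_nonneg.2 (not_lt.1 hcon))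
    linarith
  have k3 : ∀ z, 0 < X z → 0 < p z → 0 ≤ Y z → 0 < q z := by
    intro z h1 h2 h3
    have e := hpe z
    have e1 := mul_nonneg hβ.le h3
    have hα : 0 < c.re := by
      by_contra hcon
      have := mul_nonneg (neg_nonneg.2 (not_lt.1 hcon)) h1.le
      linarith
    rw [hqe]
    have := mul_pos hβ h1
    have := mul_nonneg hα.le h3
    linarith
  have k4 : ∀ z, q z = 0 → p z < 0 → 0 < Y z := by
    intro z h1 h2
    have e := r2 z
    rw [h1] at e
    have e1 := mul_pos hβ (neg_pos.2 h2)
    by_contra hcon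
    have e2 := mul_nonneg hn.le (neg_nonneg.2 (not_lt.1 hcon))
    linarith
  have k5 : ∀ z, q z = 0 → 0 < Y z → p z < 0 := by
    intro z h1 h2
    have e := r2 z
    rw [h1] at e
    have e1 := mul_pos hn h2
    by_contra hcon
    have e2 := mul_nonneg hβ.le (not_lt.1 hcon)
    linarith
  have k6 : ∀ z, Y z = 0 → X z < 0 → q z < 0 := by
    intro z h1 h2
    rw [hqe, h1]
    have := mul_pos hβ (neg_pos.2 h2)
    linarith
  have k7 : ∀ z, Y z = 0 → q z ≤ 0 → X z ≤ 0 := by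
    intro z h1 h2
    rw [hqe, h1] at h2
    by_contra hcon
    have := mul_pos hβ (not_le.1 hcon)
    linarith
  have k8 : ∀ z, X z = 0 → Y z ≤ 0 → 0 ≤ p z := by
    intro z h1 h2
    rw [hpe, h1]
    have := mul_nonneg hβ.le (neg_nonneg.2 h2)
    linarith
  have k9 : ∀ z, p z = 0 → 0 ≤ q z → 0 ≤ X z := by
    intro z h1 h2
    have e := r1 z
    rw [h1] at e
    have e1 := mul_nonneg hβ.le h2
    by_contra hcon
    have e2 := mul_pos hn (neg_pos.2 (not_le.1 hcon))
    linarith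
  have k10 : ∀ z, X z ≤ 0 → 0 ≤ Y z → 0 < q z → p z ≤ 0 := by
    intro z h1 h2 h3
    have e := hqe z
    have e1 := mul_nonneg hβ.le (neg_nonneg.2 h1)
    have hα : 0 ≤ c.re := by
      by_contra hcon
      have := mul_nonneg (neg_nonneg.2 (not_le.1 hcon).le) h2
      linarith
    rw [hpe]
    have := mul_nonneg hα (neg_nonneg.2 h1)
    have := mul_nonneg hβ.le h2
    linarith
  have k11 : ∀ z, p z ≤ 0 → Y z ≤ 0 → 0 < X z → 0 ≤ q z := by
    intro z h1 h2 h3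
    have e := hpe z
    have e1 := mul_nonneg hβ.le (neg_nonneg.2 h2)
    have hα : c.re ≤ 0 := by
      by_contra hcon
      have := mul_pos (not_le.1 hcon) h3
      linarith
    rw [hqe]
    have := mul_nonneg (neg_nonneg.2 hα) (neg_nonneg.2 h2)
    have := mul_pos hβ h3
    linarith
  -- the four sides
  have hsides : sides c = {z | (Y z = -h ∧ X z ≤ 0) ∨ (X z = 0 ∧ -h ≤ Y z ∧ Y z ≤ 0) ∨
      (p z = 0 ∧ 0 ≤ q z ∧ q z ≤ h) ∨ (q z = h ∧ p z ≤ 0)} := by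
    have hl0 : ell c 0 = w := by simp [ell, hw]
    have hl1 : ell c 1 = w / c := by simp [ell, hw]
    have hl2 : ell c (1 + 1) = w / c ^ 2 := by
      rw [ell, if_pos (by norm_num), hw]
      norm_cast
    have hc1 : c * ell c 1 = w := by rw [hl1, mul_div_cancel₀ _ hc0]
    have hc2 : c ^ 2 * ell c 1 = c * w := by rw [sq, mul_assoc, hc1]
    have hcm : c * mid c 0 = (c * w + w) / 2 := by
      rw [mid, zero_add, hl0, hl1]
      field_simp
    have hcm1 : c ^ 2 * mid c 1 = (c * w + w) / 2 := by
      rw [mid, hl1, hl2]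
      field_simp
    have hX0 : X (mid c 0) = 0 := by
      rw [hX, hcm]
      simp only [div_ofNat_re, add_re, hre']
      ring
    have hY0 : Y (mid c 0) = -h := by
      rw [hY, hcm]
      simp only [div_ofNat_im, add_im, him']
      linarith
    have hXl : X (ell c 1) = 0 := by rw [hX, hc1, sub_self]
    have hYl : Y (ell c 1) = 0 := by rw [hY, hc1, sub_self]
    have hpl : p (ell c 1) = 0 := by rw [hp, hc2, hre', sub_self]
    have hql : q (ell c 1) = 0 := by rw [hq, hc2, sub_self]
    have hp1 : p (mid c 1) = 0 := by
      rw [hp, hcm1]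
      simp only [div_ofNat_re, add_re, hre']
      ring
    have hq1 : q (mid c 1) = h := by
      rw [hq, hcm1]
      simp only [div_ofNat_im, add_im, him']
      linarith
    have hXt : ∀ t : ℝ, X (mid c 0 - t / c) = -t := by
      intro t
      have : c * (mid c 0 - t / c) = c * mid c 0 - t := by field_simp
      rw [hX, this, sub_re, ofReal_re]
      rw [hX] at hX0
      linarith
    have hYt : ∀ t : ℝ, Y (mid c 0 - t / c) = -h := by
      intro t
      have : c * (mid c 0 - t / c) = c * mid c 0 - t := by field_simp
      rw [hY, this, sub_im, ofReal_im]
      rw [hY] at hY0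
      linarith
    have hpt : ∀ t : ℝ, p (mid c 1 - t / c ^ 2) = -t := by
      intro t
      have : c ^ 2 * (mid c 1 - t / c ^ 2) = c ^ 2 * mid c 1 - t := by field_simp
      rw [hp, this, sub_re, ofReal_re]
      rw [hp] at hp1
      linarith
    have hqt : ∀ t : ℝ, q (mid c 1 - t / c ^ 2) = h := by
      intro t
      have : c ^ 2 * (mid c 1 - t / c ^ 2) = c ^ 2 * mid c 1 - t := by field_simp
      rw [hq, this, sub_im, ofReal_im]
      rw [hq] at hq1
      linarith
    ext z
    simp only [sides, mem_union, mem_ofPred_eq, or_assoc]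
    refine or_congr ?_ (or_congr ?_ (or_congr ?_ ?_))
    · constructor
      · rintro ⟨t, ht, rfl⟩
        rw [hXt, hYt]
        exact ⟨rfl, by linarith⟩
      · rintro ⟨h1, h2⟩
        refine ⟨-X z, by linarith, hinj _ _ ?_ ?_⟩
        · rw [hXt, neg_neg]
        · rw [hYt, h1]
    · constructor
      · rintro ⟨s, t, hs, ht, hst, rfl⟩
        rw [hXa s t _ _ hst, hYa s t _ _ hst, hX0, hY0, hXl, hYl]
        refine ⟨by ring, ?_, ?_⟩ <;> nlinarith
      · rintro ⟨h1, h2, h3⟩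
        have hst : -Y z / h + (1 + Y z / h) = 1 := by ring
        refine ⟨-Y z / h, 1 + Y z / h, div_nonneg (by linarith) hhp.le, ?_, hst, hinj _ _ ?_ ?_⟩
        · rw [← sub_nonneg] at h2
          have : 1 + Y z / h = (Y z - -h) / h := by field_simp; ring
          rw [this]
          exact div_nonneg h2 hhp.le
        · rw [hXa _ _ _ _ hst, hX0, hXl, h1]
          ring
        · rw [hYa _ _ _ _ hst, hY0, hYl]
          field_simp
          ring
    · constructor
      · rintro ⟨s, t, hs, ht, hst, rfl⟩
        rw [hpa s t _ _ hst, hqa s t _ _ hst, hp1, hq1, hpl, hql]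
        refine ⟨by ring, ?_, ?_⟩ <;> nlinarith
      · rintro ⟨h1, h2, h3⟩
        have hst : (1 - q z / h) + q z / h = 1 := by ring
        refine ⟨1 - q z / h, q z / h, ?_, div_nonneg h2 hhp.le, hst, hinj2 _ _ ?_ ?_⟩
        · have : 1 - q z / h = (h - q z) / h := by field_simp
          rw [this]
          exact div_nonneg (by linarith) hhp.le
        · rw [hpa _ _ _ _ hst, hp1, hpl, h1]
          ring
        · rw [hqa _ _ _ _ hst, hq1, hql]
          field_simp
          ring
    · constructor
      · rintro ⟨t, ht, rfl⟩
        rw [hpt, hqt]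
        exact ⟨rfl, by linarith⟩
      · rintro ⟨h1, h2⟩
        refine ⟨-p z, by linarith, hinj2 _ _ ?_ ?_⟩
        · rw [hpt, neg_neg]
        · rw [hqt, h1]
  obtain ⟨E, hE⟩ : ∃ E : Set ℂ, E = {z | (X z ≤ 0 ∧ -h ≤ Y z ∧ Y z ≤ 0) ∨ (0 ≤ Y z ∧ q z ≤ 0) ∨
      (p z ≤ 0 ∧ 0 ≤ q z ∧ q z ≤ h)} := ⟨_, rfl⟩
  obtain ⟨N, hN⟩ : ∃ N : Set ℂ, N = ((Y ⁻¹' Iio (-h) ∪ (X ⁻¹' Ioi 0 ∩ p ⁻¹' Ioi 0)) ∪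
      (q ⁻¹' Ioi h ∩ X ⁻¹' Ioi 0)) ∪ (q ⁻¹' Ioi h ∩ p ⁻¹' Iic 0) := ⟨_, rfl⟩
  obtain ⟨U, hU⟩ : ∃ U : Set ℂ, U = {z | (X z < 0 ∧ -h < Y z ∧ Y z < 0) ∨ (0 < Y z ∧ q z < 0) ∨
      (p z < 0 ∧ 0 < q z ∧ q z < h) ∨ (X z < 0 ∧ -h < Y z ∧ q z < 0) ∨
      (0 < Y z ∧ p z < 0 ∧ q z < h)} := ⟨_, rfl⟩
  have hmemE : ∀ z, z ∈ E ↔ ((X z ≤ 0 ∧ -h ≤ Y z ∧ Y z ≤ 0) ∨ (0 ≤ Y z ∧ q z ≤ 0) ∨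
      (p z ≤ 0 ∧ 0 ≤ q z ∧ q z ≤ h)) := by
    intro z
    rw [hE, mem_ofPred_eq]
  have hmemU : ∀ z, z ∈ U ↔ ((X z < 0 ∧ -h < Y z ∧ Y z < 0) ∨ (0 < Y z ∧ q z < 0) ∨
      (p z < 0 ∧ 0 < q z ∧ q z < h) ∨ (X z < 0 ∧ -h < Y z ∧ q z < 0) ∨
      (0 < Y z ∧ p z < 0 ∧ q z < h)) := by
    intro z
    rw [hU, mem_ofPred_eq]
  have hmemN : ∀ z, z ∈ N ↔ (((Y z < -h ∨ (0 < X z ∧ 0 < p z)) ∨ (h < q z ∧ 0 < X z)) ∨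
      (h < q z ∧ p z ≤ 0)) := by
    intro z
    rw [hN]
    simp
  have hmemS : ∀ z, z ∈ sides c ↔ ((Y z = -h ∧ X z ≤ 0) ∨ (X z = 0 ∧ -h ≤ Y z ∧ Y z ≤ 0) ∨
      (p z = 0 ∧ 0 ≤ q z ∧ q z ≤ h) ∨ (q z = h ∧ p z ≤ 0)) := by
    intro z
    rw [hsides, mem_ofPred_eq]
  have hNE : N = Eᶜ := by
    ext z
    rw [mem_compl_iff, hmemN, hmemE]
    constructor
    · rintro (((h1 | ⟨h1, h2⟩) | ⟨h1, h2⟩) | ⟨h1, h2⟩) (⟨g1, g2, g3⟩ | ⟨g1, g2⟩ | ⟨g1, g2, g3⟩)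
      · linarith
      · linarith
      · linarith [k1 z g1 g2 g3]
      · linarith
      · linarith [k3 z h1 h2 g1]
      · linarith
      · linarith
      · linarith
      · linarith
      · linarith [k2 z h2 (by linarith) g3]
      · linarith
      · linarith
    · intro hz
      rcases lt_or_ge (Y z) (-h) with h1 | h1
      · exact Or.inl (Or.inl (Or.inl h1))
      rcases lt_or_ge 0 (p z) with h2 | h2
      · rcases lt_or_ge 0 (X z) with h3 | h3
        · exact Or.inl (Or.inl (Or.inr ⟨h3, h2⟩))
        · exfalso
          rcases le_total (Y z) 0 with h4 | h4
          · exact hz (Or.inl ⟨h3, h1, h4⟩)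
          · rcases lt_or_ge 0 (q z) with h5 | h5
            · linarith [k10 z h3 h4 h5]
            · exact hz (Or.inr (Or.inl ⟨h4, h5⟩))
      · rcases lt_or_ge h (q z) with h3 | h3
        · exact Or.inr ⟨h3, h2⟩
        · exfalso
          rcases lt_or_ge (q z) 0 with h4 | h4
          · rcases le_total (Y z) 0 with h5 | h5
            · rcases lt_or_ge 0 (X z) with h6 | h6
              · linarith [k11 z h2 h5 h6]
              · exact hz (Or.inl ⟨h6, h1, h5⟩)
            · exact hz (Or.inr (Or.inl ⟨h5, h4.le⟩))
          · exact hz (Or.inr (Or.inr ⟨h2, h4, h3⟩))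
  have hcover : ∀ z, z ∉ sides c → z ∈ N ∨ z ∈ U := by
    intro z hz
    by_contra hcon
    rw [not_or, hNE, mem_compl_iff, not_not, hmemE] at hcon
    obtain ⟨hE', hU'⟩ := hcon
    apply hU'
    rw [hmemU]
    rw [hmemS] at hz
    have ne : ∀ {a b : ℝ}, a ≤ b → a ≠ b → a < b := fun h1 h2 => lt_of_le_of_ne h1 h2
    rcases hE' with ⟨h1, h2, h3⟩ | ⟨h1, h2⟩ | ⟨h1, h2, h3⟩
    · have e1 : X z < 0 := ne h1 fun e => hz (Or.inr (Or.inl ⟨e, h2, h3⟩))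
      have e2 : -h < Y z := ne h2 fun e => hz (Or.inl ⟨e.symm, h1⟩)
      rcases h3.lt_or_eq with h3 | h3
      · exact Or.inl ⟨e1, e2, h3⟩
      · exact Or.inr (Or.inr (Or.inr (Or.inl ⟨e1, e2, k6 z h3 e1⟩)))
    · rcases h1.lt_or_eq with h1 | h1
      · rcases h2.lt_or_eq with h2 | h2
        · exact Or.inr (Or.inl ⟨h1, h2⟩)
        · exact Or.inr (Or.inr (Or.inr (Or.inr ⟨h1, k5 z h2 h1, by linarith⟩)))
      · have e1 : X z < 0 := ne (k7 z h1.symm h2) fun e =>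
          hz (Or.inr (Or.inl ⟨e, by linarith, by linarith⟩))
        exact Or.inr (Or.inr (Or.inr (Or.inl ⟨e1, by linarith, k6 z h1.symm e1⟩)))
    · have e1 : p z < 0 := ne h1 fun e => hz (Or.inr (Or.inr (Or.inl ⟨e, h2, h3⟩)))
      have e2 : q z < h := ne h3 fun e => hz (Or.inr (Or.inr (Or.inr ⟨e, h1⟩)))
      rcases h2.lt_or_eq with h2 | h2
      · exact Or.inr (Or.inr (Or.inl ⟨e1, h2, e2⟩))
      · exact Or.inr (Or.inr (Or.inr (Or.inr ⟨k4 z h2.symm e1, e1, e2⟩)))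
  have hUE : U ⊆ E \ sides c := by
    intro z hz
    rw [hmemU] at hz
    rw [mem_sdiff, hmemE, hmemS]
    constructor
    · rcases hz with ⟨h1, h2, h3⟩ | ⟨h1, h2⟩ | ⟨h1, h2, h3⟩ | ⟨h1, h2, h3⟩ | ⟨h1, h2, h3⟩
      · exact Or.inl ⟨h1.le, h2.le, h3.le⟩
      · exact Or.inr (Or.inl ⟨h1.le, h2.le⟩)
      · exact Or.inr (Or.inr ⟨h1.le, h2.le, h3.le⟩)
      · rcases le_total (Y z) 0 with h4 | h4
        · exact Or.inl ⟨h1.le, h2.le, h4⟩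
        · exact Or.inr (Or.inl ⟨h4, h3.le⟩)
      · rcases le_total (q z) 0 with h4 | h4
        · exact Or.inr (Or.inl ⟨h1.le, h4⟩)
        · exact Or.inr (Or.inr ⟨h2.le, h4, h3.le⟩)
    · rintro (⟨g1, g2⟩ | ⟨g1, g2, g3⟩ | ⟨g1, g2, g3⟩ | ⟨g1, g2⟩)
      · rcases hz with ⟨h1, h2, h3⟩ | ⟨h1, h2⟩ | ⟨h1, h2, h3⟩ | ⟨h1, h2, h3⟩ | ⟨h1, h2, h3⟩
        · linarith
        · linarith
        · linarith [k1 z h1.le h2.le h3.le]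
        · linarith
        · linarith
      · rcases hz with ⟨h1, h2, h3⟩ | ⟨h1, h2⟩ | ⟨h1, h2, h3⟩ | ⟨h1, h2, h3⟩ | ⟨h1, h2, h3⟩
        · linarith
        · linarith
        · linarith [k8 z g1 g3]
        · linarith
        · linarith
      · rcases hz with ⟨h1, h2, h3⟩ | ⟨h1, h2⟩ | ⟨h1, h2, h3⟩ | ⟨h1, h2, h3⟩ | ⟨h1, h2, h3⟩
        · linarith [k9 z g1 g2]
        · linarith
        · linarith
        · linarith
        · linarith
      · rcases hz with ⟨h1, h2, h3⟩ | ⟨h1, h2⟩ | ⟨h1, h2, h3⟩ | ⟨h1, h2, h3⟩ | ⟨h1, h2, h3⟩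
        · linarith [k2 z g2 (by linarith) h3.le]
        · linarith
        · linarith
        · linarith
        · linarith
  have hNS : N ⊆ (sides c)ᶜ := by
    intro z hz
    rw [hNE, mem_compl_iff, hmemE] at hz
    rw [mem_compl_iff, hmemS]
    rintro (⟨g1, g2⟩ | ⟨g1, g2, g3⟩ | ⟨g1, g2, g3⟩ | ⟨g1, g2⟩)
    · exact hz (Or.inl ⟨g2, by linarith, by linarith⟩)
    · exact hz (Or.inl ⟨g1.le, g2, g3⟩)
    · exact hz (Or.inr (Or.inr ⟨g1.le, g2, g3⟩))
    · exact hz (Or.inr (Or.inr ⟨g2, by linarith, g1.le⟩))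
  have hEc : IsClosed E := by
    rw [hE]
    refine IsClosed.union ?_ (IsClosed.union ?_ ?_)
    · exact (isClosed_le hXc continuous_const).inter
        ((isClosed_le continuous_const hYc).inter (isClosed_le hYc continuous_const))
    · exact (isClosed_le continuous_const hYc).inter (isClosed_le hqc continuous_const)
    · exact (isClosed_le hpc continuous_const).inter
        ((isClosed_le continuous_const hqc).inter (isClosed_le hqc continuous_const))
  have hUo : IsOpen U := by
    rw [hU]
    refine IsOpen.union ?_ (IsOpen.union ?_ (IsOpen.union ?_ (IsOpen.union ?_ ?_)))
    · exact (isOpen_lt hXc continuous_const).inter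
        ((isOpen_lt continuous_const hYc).inter (isOpen_lt hYc continuous_const))
    · exact (isOpen_lt continuous_const hYc).inter (isOpen_lt hqc continuous_const)
    · exact (isOpen_lt hpc continuous_const).inter
        ((isOpen_lt continuous_const hqc).inter (isOpen_lt hqc continuous_const))
    · exact (isOpen_lt hXc continuous_const).inter
        ((isOpen_lt continuous_const hYc).inter (isOpen_lt hqc continuous_const))
    · exact (isOpen_lt continuous_const hYc).inter
        ((isOpen_lt hpc continuous_const).inter (isOpen_lt hqc continuous_const))
  have hsurj2 : ∀ a b : ℝ, ∃ z, p z = a ∧ q z = b := by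
    intro a b
    obtain ⟨z, h1, h2⟩ := hsurj ((c.re * a + c.im * b) / (c.re * c.re + c.im * c.im))
      ((c.re * b - c.im * a) / (c.re * c.re + c.im * c.im))
    have hn' := hn.ne'
    have hn2 : c.re ^ 2 + c.im ^ 2 ≠ 0 := by rw [sq, sq]; exact hn'
    refine ⟨z, ?_, ?_⟩
    · rw [hpe, h1, h2]
      field_simp
      ring
    · rw [hqe, h1, h2]
      field_simp
      ring
  have hNpre : IsPreconnected N := by
    have c1 : IsPreconnected (Y ⁻¹' Iio (-h)) := (cvx Y hYa _ (convex_Iio _)).isPreconnected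
    have c2 : IsPreconnected (X ⁻¹' Ioi 0 ∩ p ⁻¹' Ioi 0) :=
      ((cvx X hXa _ (convex_Ioi _)).inter (cvx p hpa _ (convex_Ioi _))).isPreconnected
    have c3 : IsPreconnected (q ⁻¹' Ioi h ∩ X ⁻¹' Ioi 0) :=
      ((cvx q hqa _ (convex_Ioi _)).inter (cvx X hXa _ (convex_Ioi _))).isPreconnected
    have c4 : IsPreconnected (q ⁻¹' Ioi h ∩ p ⁻¹' Iic 0) :=
      ((cvx q hqa _ (convex_Ioi _)).inter (cvx p hpa _ (convex_Iic _))).isPreconnected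
    have hab : 0 < |c.re| / c.im + 1 := by positivity
    have hab' : c.im * (|c.re| / c.im + 1) = |c.re| + c.im := by field_simp
    rw [hN]
    obtain ⟨z1, hz1, hz1'⟩ := hsurj 1 (-h - (|c.re| / c.im + 1))
    obtain ⟨z2, hz2, hz2'⟩ := hsurj2 1 (h + (|c.re| / c.im + 1))
    obtain ⟨z3, hz3, hz3'⟩ := hsurj2 0 (h + 1)
    refine IsPreconnected.union z3 ?_ ?_ (IsPreconnected.union z2 ?_ ?_
      (IsPreconnected.union z1 ?_ ?_ c1 c2) c3) c4
    · right
      refine ⟨by simp [hz3'], ?_⟩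
      have e := r1 z3
      rw [hz3, hz3'] at e
      have e1 := mul_pos hβ (by linarith : 0 < h + 1)
      by_contra hcon
      have e2 := mul_nonneg hn.le (neg_nonneg.2 (not_lt.1 hcon))
      linarith
    · exact ⟨by simp [hz3'], by simp [hz3]⟩
    · right
      refine ⟨?_, by simp [hz2]⟩
      have e := r1 z2
      rw [hz2, hz2'] at e
      have e1 := mul_pos hβ hhp
      have e3 := neg_abs_le c.re
      by_contra hcon
      have e2 := mul_nonneg hn.le (neg_nonneg.2 (not_lt.1 hcon))
      linarith
    · refine ⟨by simp only [mem_preimage, mem_Ioi, hz2']; linarith, ?_⟩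
      have e := r1 z2
      rw [hz2, hz2'] at e
      have e1 := mul_pos hβ hhp
      have e3 := neg_abs_le c.re
      by_contra hcon
      have e2 := mul_nonneg hn.le (neg_nonneg.2 (not_lt.1 hcon))
      linarith
    · simp only [mem_preimage, mem_Iio, hz1']
      linarith
    · refine ⟨by simp [hz1], ?_⟩
      have e := hpe z1
      rw [hz1, hz1'] at e
      have e1 := mul_pos hβ hhp
      have e3 := neg_abs_le c.re
      simp only [mem_preimage, mem_Ioi]
      linarith
  have h0N : (0 : ℂ) ∈ N := by
    rw [hmemN]
    left; left; right
    rw [hX, hp]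
    simp [hre0]
  have hcomp : connectedComponentIn (sides c)ᶜ 0 = N := by
    apply Subset.antisymm
    · apply isPreconnected_connectedComponentIn.subset_left_of_subset_union (v := U)
      · rw [hNE]
        exact hEc.isOpen_compl
      · exact hUo
      · rw [hNE]
        exact disjoint_left.2 fun z hz hz' => hz (hUE hz').1
      · intro z hz
        exact hcover z (connectedComponentIn_subset _ _ hz)
      · exact ⟨0, mem_connectedComponentIn (hNS h0N), h0N⟩
    · exact hNpre.subset_connectedComponentIn h0N hNS
  have hfin : (sides c ∪ connectedComponentIn (sides c)ᶜ 0)ᶜ = U := by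
    rw [hcomp]
    ext z
    constructor
    · intro hz
      rw [mem_compl_iff, mem_union, not_or] at hz
      exact (hcover z hz.1).resolve_left hz.2
    · intro hz hz'
      rcases hz' with hz' | hz'
      · exact (hUE hz).2 hz'
      · rw [hNE] at hz'
        exact hz' (hUE hz).1
  have hseg : ∀ z z', openSegment ℝ z z' ⊆ U → z ∈ closure U := by
    intro z z' hzz
    exact closure_mono hzz (segment_subset_closure_openSegment (left_mem_segment ℝ z z'))
  have hclos : closure U = E := by
    apply Subset.antisymm
    · exact closure_minimal (fun z hz => (hUE hz).1) hEc
    · intro z hz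
      rw [hmemE] at hz
      rcases hz with ⟨h1, h2, h3⟩ | ⟨h1, h2⟩ | ⟨h1, h2, h3⟩
      · obtain ⟨z', e1, e2⟩ := hsurj (-1) (-h / 2)
        refine hseg z z' ?_
        rintro _ ⟨s, t, hs, ht, hst, rfl⟩
        rw [hmemU, hXa s t _ _ hst, hYa s t _ _ hst, e1, e2]
        left
        refine ⟨?_, ?_, ?_⟩ <;> nlinarith
      · obtain ⟨z', e1, e2⟩ := hsurj (-(c.re + 1) / c.im) 1
        have e3 : q z' = -1 := by
          rw [hqe, e1, e2]
          field_simp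
          ring
        refine hseg z z' ?_
        rintro _ ⟨s, t, hs, ht, hst, rfl⟩
        rw [hmemU, hqa s t _ _ hst, hYa s t _ _ hst, e2, e3]
        right; left
        constructor <;> nlinarith
      · obtain ⟨z', e1, e2⟩ := hsurj2 (-1) (h / 2)
        refine hseg z z' ?_
        rintro _ ⟨s, t, hs, ht, hst, rfl⟩
        rw [hmemU, hpa s t _ _ hst, hqa s t _ _ hst, e1, e2]
        right; right; left
        refine ⟨?_, ?_, ?_⟩ <;> nlinarith
  rw [S1, hfin, hclos]
  ext z
  rw [hmemE, mem_ofPred_eq, hX, hY, hp, hq, hhd]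
  constructor
  · rintro (⟨h1, h2, h3⟩ | ⟨h1, h2⟩ | ⟨h1, h2, h3⟩)
    · left; refine ⟨?_, ?_, ?_⟩ <;> linarith
    · right; left; constructor <;> linarith
    · right; right; refine ⟨?_, ?_, ?_⟩ <;> linarith
  · rintro (⟨h1, h2, h3⟩ | ⟨h1, h2⟩ | ⟨h1, h2, h3⟩)
    · left; refine ⟨?_, ?_, ?_⟩ <;> linarith
    · right; left; constructor <;> linarith
    · right; right; refine ⟨?_, ?_, ?_⟩ <;> linarith
end TwistedTent

end

/-!
Write `ℓ₀ = x₀ + i y₀` and `N = |c|²`. The proof rests on one inequality, valid for every `z`: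
`Re f(f z) - x₀ ≤ N (Re z - x₀)` (`re_f_f_sub_le`). Points to the left of the vertical line through
`ℓ₀` therefore escape, and since `Re f z = Re (c z)`, the set `K` satisfies `x₀ ≤ Re z` and
`x₀ ≤ Re (c z)` (`ell0_re_le_of_mem_K`, `ell0_re_le_mul_of_mem_K`).

*`K ⊆ P`* (`K_subset_P`). The set `S₁` lies above the pre-folding line, beyond the line
`Re (c z) = x₀` or beyond `Re (c² z) = x₀`. By the bounds on `K`, a point of `K` that is moved
slightly towards the origin leaves all `S_k`, so it is not interior to `S ∪ S'`.

*The spiral.* The vertices `ℓ_k = ℓ₀ / c ^ k` satisfy `f ℓ_{k+1} = ℓ_k` while `Im ℓ_k ≥ -1`. The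
existence of `ζ` says that `Im ℓ_k > -1` for `k < n` and `Im ℓ_n ≤ -1` (`FirstCrossing`); in
particular `ℓ_k ∈ K` for `k ≤ n`. If some `ℓ_m`, `1 ≤ m < n`, were in the triangle with corners
`0`, `c ℓ₀`, `ℓ₀`, then all later vertices would be sub-convex combinations of earlier ones, and
`ℓ_n` could not be below the folding line (`FirstCrossing.not_combination`). With the bounds on `K`
this shows that the spiral makes less than one turn before `n` (`FirstCrossing.pow_im_neg`) and
that `Re ℓ_m > x₀` (`FirstCrossing.ell0_re_lt_vertex_re`).

*`γ₀ ∉ K`* (`FirstCrossing.gamma0_notMem_K`). Because `Im ζ > -1`, the point `γ₀` lies on the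
pre-folding line beyond `L_n`, that is `Re (c ^ (n + 1) γ₀) < x₀`. The numbers `c ^ j γ₀`, `j ≤ n`,
are above the folding line: their heights are monotone as long as `Im (c ^ j)` keeps its sign,
which it changes only once. So `f ^ n γ₀ = c ^ n γ₀`, which is not in `K`.

*`P` is not the polygon* (`FirstCrossing.P_ne_regionBoundedBy`). Close to `ζ` there is an open set
of points beyond `L_n` which lies in `S` (`cap`, `FirstCrossing.mem_closure_cap`). As it is above
the folding line, its quotient by `c` is again in `S`, but it lies inside the polygon. That the
polygon is inside the outer-most boundary is checked by exhibiting it as a bounded open set whose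
frontier is contained in that curve (`FirstCrossing.closure_polygon_subset`).

*`K ≠ P`* (`FirstCrossing.K_ssubset_P`). A point `g` of `cap` close to `ζ` escapes. It has a preimage
`y` below the pre-folding line, and `y / c` is a preimage of `y` which is in `P`, because `y`
belongs neither to `f(S₁)` nor to the upper half plane containing `S`.
-/

namespace TwistedTent

open Complex Set Filter Topology

/-! ### The parameter and the fixed point `ℓ₀` -/

lemma one_lt_normSq {c : ℂ} (hc : 1 < ‖c‖) : 1 < normSq c := by
  rw [normSq_eq_norm_sq]
  nlinarith

lemma ne_zero_of_im_pos {c : ℂ} (hβ : 0 < c.im) : c ≠ 0 := by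
  rintro rfl
  simp at hβ

lemma normSq_sub_one_mul_ell0_re {c : ℂ} (hc : 1 < ‖c‖) :
    (normSq c - 1) * (ell0 c).re = -2 * c.im := by
  have h := one_lt_normSq hc
  have hD : ((‖c‖ : ℂ) ^ 2 - 1) = ((normSq c - 1 : ℝ) : ℂ) := by
    rw [normSq_eq_norm_sq]
    push_cast
    rfl
  rw [ell0, hD, div_ofReal_re, mul_div_cancel₀ _ (by linarith)]
  simp

lemma normSq_sub_one_mul_ell0_im {c : ℂ} (hc : 1 < ‖c‖) :
    (normSq c - 1) * (ell0 c).im = 2 * (1 - c.re) := by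
  have h := one_lt_normSq hc
  have hD : ((‖c‖ : ℂ) ^ 2 - 1) = ((normSq c - 1 : ℝ) : ℂ) := by
    rw [normSq_eq_norm_sq]
    push_cast
    rfl
  rw [ell0, hD, div_ofReal_im, mul_div_cancel₀ _ (by linarith)]
  simp

lemma ell0_re_neg {c : ℂ} (hc : 1 < ‖c‖) (hβ : 0 < c.im) : (ell0 c).re < 0 := by
  have h1 := normSq_sub_one_mul_ell0_re hc
  have h2 := one_lt_normSq hc
  by_contra h
  have := mul_nonneg (by linarith : 0 ≤ normSq c - 1) (not_lt.1 h)
  linarith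

lemma neg_one_lt_ell0_im {c : ℂ} (hc : 1 < ‖c‖) (hβ : 0 < c.im) : -1 < (ell0 c).im := by
  have h1 := normSq_sub_one_mul_ell0_im hc
  have h2 := one_lt_normSq hc
  have h3 := normSq_apply c
  by_contra h
  have h4 := mul_nonneg (by linarith : 0 ≤ normSq c - 1) (by linarith : 0 ≤ -1 - (ell0 c).im)
  nlinarith [mul_pos hβ hβ, sq_nonneg (c.re - 1)]

lemma mul_ell0_re {c : ℂ} (hc : 1 < ‖c‖) : (c * ell0 c).re = (ell0 c).re := by
  have h1 := normSq_sub_one_mul_ell0_re hc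
  have h2 := normSq_sub_one_mul_ell0_im hc
  have h3 := one_lt_normSq hc
  apply mul_left_cancel₀ (by linarith : normSq c - 1 ≠ 0)
  rw [mul_re]
  linear_combination (c.re - 1) * h1 - c.im * h2

lemma mul_ell0_im {c : ℂ} (hc : 1 < ‖c‖) : (c * ell0 c).im = -2 - (ell0 c).im := by
  have h1 := normSq_sub_one_mul_ell0_re hc
  have h2 := normSq_sub_one_mul_ell0_im hc
  have h3 := one_lt_normSq hc
  apply mul_left_cancel₀ (by linarith : normSq c - 1 ≠ 0)
  rw [mul_im]
  linear_combination c.im * h1 + (c.re + 1) * h2 + 2 * normSq_apply c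

/-! ### The twisted tent map and its filled-in Julia set -/

lemma reflectFL_re (z : ℂ) : (reflectFL z).re = z.re := by simp [reflectFL]

lemma reflectFL_im (z : ℂ) : (reflectFL z).im = -2 - z.im := by
  simp [reflectFL]
  ring

lemma reflectFL_reflectFL (z : ℂ) : reflectFL (reflectFL z) = z := by
  apply Complex.ext
  · simp only [reflectFL_re]
  · simp only [reflectFL_im]
    ring

lemma reflectFL_of_im_eq {z : ℂ} (h : z.im = -1) : reflectFL z = z := by
  apply Complex.ext
  · rw [reflectFL_re]
  · rw [reflectFL_im]
    linarith

lemma continuous_reflectFL : Continuous reflectFL := by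
  unfold reflectFL
  fun_prop

lemma f_of_le {c z : ℂ} (h : -1 ≤ (c * z).im) : f c z = c * z := if_pos h

lemma f_of_ge {c z : ℂ} (h : (c * z).im ≤ -1) : f c z = reflectFL (c * z) := by
  rcases h.lt_or_eq with h | h
  · exact if_neg h.not_ge
  · rw [f_of_le h.ge, reflectFL_of_im_eq h]

lemma neg_one_le_f_im (c z : ℂ) : -1 ≤ (f c z).im := by
  rcases le_total (-1) (c * z).im with h | h
  · rwa [f_of_le h]
  · rw [f_of_ge h, reflectFL_im]
    linarith

lemma f_re (c z : ℂ) : (f c z).re = (c * z).re := by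
  rcases le_total (-1) (c * z).im with h | h
  · rw [f_of_le h]
  · rw [f_of_ge h, reflectFL_re]

lemma continuous_f (c : ℂ) : Continuous (f c) := by
  unfold f
  refine Continuous.if_le (by fun_prop) (continuous_reflectFL.comp (by fun_prop))
    continuous_const (by fun_prop) fun z hz => ?_
  exact (reflectFL_of_im_eq hz.symm).symm

lemma mem_PHPlus_iff {c z : ℂ} : z ∈ PHPlus c ↔ -1 ≤ (c * z).im := by
  refine ⟨fun h => ?_, f_of_le⟩
  rw [← show f c z = c * z from h]
  exact neg_one_le_f_im c z

lemma mem_PFL_iff {c z : ℂ} : z ∈ PFL c ↔ (c * z).im = -1 := by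
  change (f c z).im = -1 ↔ _
  rcases le_total (-1) (c * z).im with h | h
  · rw [f_of_le h]
  · rw [f_of_ge h, reflectFL_im]
    constructor <;> intro h' <;> linarith

/-- Seen from the vertical line through `ℓ₀`, the second iterate of `f` expands horizontal
distances on the left by at least the factor `|c|²`. There is equality where `f` folds. -/
lemma re_f_f_sub_le {c : ℂ} (hc : 1 < ‖c‖) (hβ : 0 < c.im) (z : ℂ) :
    (f c (f c z)).re - (ell0 c).re ≤ normSq c * (z.re - (ell0 c).re) := by
  have h1 := normSq_sub_one_mul_ell0_re hc
  rw [f_re]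
  rcases le_total (-1) (c * z).im with h | h
  · rw [f_of_le h]
    have h2 := mul_le_mul_of_nonneg_left h hβ.le
    simp only [mul_re, mul_im, normSq_apply] at *
    linarith
  · rw [f_of_ge h, mul_re, reflectFL_re, reflectFL_im]
    simp only [mul_re, mul_im, normSq_apply] at *
    linarith

lemma mem_K_iff {c z : ℂ} : z ∈ K c ↔ ∃ C : ℝ, ∀ n : ℕ, ‖(f c)^[n] z‖ ≤ C := by
  change Bornology.IsBounded (range fun n : ℕ => (f c)^[n] z) ↔ _
  rw [isBounded_iff_forall_norm_le]
  simp

lemma f_mem_K_iff {c z : ℂ} : f c z ∈ K c ↔ z ∈ K c := by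
  rw [mem_K_iff, mem_K_iff]
  constructor
  · rintro ⟨C, hC⟩
    refine ⟨max C ‖z‖, fun n => ?_⟩
    cases n with
    | zero => exact le_max_right _ _
    | succ n => exact (hC n).trans (le_max_left _ _)
  · rintro ⟨C, hC⟩
    exact ⟨C, fun n => hC (n + 1)⟩

/-- The filled-in Julia set lies to the right of the vertical line through `ℓ₀`. -/
lemma ell0_re_le_of_mem_K {c z : ℂ} (hc : 1 < ‖c‖) (hβ : 0 < c.im) (hz : z ∈ K c) :
    (ell0 c).re ≤ z.re := by
  by_contra! hlt
  obtain ⟨C, hC⟩ := mem_K_iff.1 hz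
  have hN := one_lt_normSq hc
  have key : ∀ k : ℕ, ((f c)^[2 * k] z).re - (ell0 c).re ≤
      normSq c ^ k * (z.re - (ell0 c).re) := by
    intro k
    induction k with
    | zero => simp
    | succ k ih =>
      have e : (f c)^[2 * (k + 1)] z = f c (f c ((f c)^[2 * k] z)) := by
        rw [show 2 * (k + 1) = 2 * k + 1 + 1 by ring, Function.iterate_succ_apply',
          Function.iterate_succ_apply']
      rw [e, pow_succ', mul_assoc]
      exact (re_f_f_sub_le hc hβ _).trans (mul_le_mul_of_nonneg_left ih (by linarith))
  have hd : 0 < (ell0 c).re - z.re := by linarith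
  obtain ⟨k, hk⟩ := pow_unbounded_of_one_lt ((C + |(ell0 c).re|) / ((ell0 c).re - z.re)) hN
  rw [div_lt_iff₀ hd] at hk
  have h1 := key k
  have h2 := (abs_le.1 ((abs_re_le_norm _).trans (hC (2 * k)))).1
  have h3 := neg_abs_le (ell0 c).re
  have h4 := le_abs_self (ell0 c).re
  linarith

lemma ell0_re_le_mul_of_mem_K {c z : ℂ} (hc : 1 < ‖c‖) (hβ : 0 < c.im) (hz : z ∈ K c) :
    (ell0 c).re ≤ (c * z).re := by
  rw [← f_re]
  exact ell0_re_le_of_mem_K hc hβ (f_mem_K_iff.2 hz)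

/-- As long as the orbit of `z` under multiplication by `c` stays above the folding line, it is
the orbit under `f`. -/
lemma pow_mul_mem_K_iff {c z : ℂ} {k : ℕ} (h : ∀ j < k, -1 ≤ (c ^ (j + 1) * z).im) :
    c ^ k * z ∈ K c ↔ z ∈ K c := by
  induction k with
  | zero => simp
  | succ k ih =>
    rw [← ih fun j hj => h j (by omega), pow_succ', mul_assoc, ← f_of_le, f_mem_K_iff]
    rw [← mul_assoc, ← pow_succ']
    exact h k (by omega)

lemma ell0_mem_K {c : ℂ} (hc : 1 < ‖c‖) (hβ : 0 < c.im) : ell0 c ∈ K c := by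
  have h0 := neg_one_lt_ell0_im hc hβ
  have h : f c (ell0 c) = ell0 c := by
    rw [f_of_ge (by rw [mul_ell0_im hc]; linarith)]
    apply Complex.ext
    · rw [reflectFL_re, mul_ell0_re hc]
    · rw [reflectFL_im, mul_ell0_im hc]
      ring
  exact mem_K_iff.2 ⟨‖ell0 c‖, fun n => by rw [Function.iterate_fixed h]⟩

/-! ### Reflection about the pre-folding line -/

lemma mul_reflectPFL {c : ℂ} (hc : c ≠ 0) (z : ℂ) : c * reflectPFL c z = reflectFL (c * z) :=
  mul_div_cancel₀ _ hc

lemma reflectPFL_reflectPFL {c : ℂ} (hc : c ≠ 0) (z : ℂ) :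
    reflectPFL c (reflectPFL c z) = z := by
  apply mul_left_cancel₀ hc
  rw [mul_reflectPFL hc, mul_reflectPFL hc, reflectFL_reflectFL]

lemma continuous_reflectPFL (c : ℂ) : Continuous (reflectPFL c) := by
  unfold reflectPFL
  exact (continuous_reflectFL.comp (by fun_prop)).div_const _

lemma f_reflectPFL {c : ℂ} (hc : c ≠ 0) (z : ℂ) : f c (reflectPFL c z) = f c z := by
  rcases le_total (-1) (c * z).im with h | h
  · rw [f_of_le h, f_of_ge, mul_reflectPFL hc, reflectFL_reflectFL]
    rw [mul_reflectPFL hc, reflectFL_im]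
    linarith
  · rw [f_of_ge h, f_of_le, mul_reflectPFL hc]
    rw [mul_reflectPFL hc, reflectFL_im]
    linarith

/-- The open set whose complement is the perimeter set is symmetric about the pre-folding line. -/
lemma reflectPFL_mem_interior_iff {c : ℂ} (hc : c ≠ 0) (z : ℂ) :
    reflectPFL c z ∈ interior (S c ∪ reflectPFL c '' S c) ↔
      z ∈ interior (S c ∪ reflectPFL c '' S c) := by
  let e : ℂ ≃ₜ ℂ :=
    { toFun := reflectPFL c
      invFun := reflectPFL c
      left_inv := reflectPFL_reflectPFL hc
      right_inv := reflectPFL_reflectPFL hc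
      continuous_toFun := continuous_reflectPFL c
      continuous_invFun := continuous_reflectPFL c }
  have h : e ⁻¹' (S c ∪ reflectPFL c '' S c) = S c ∪ reflectPFL c '' S c := by
    have h1 : reflectPFL c ⁻¹' S c = reflectPFL c '' S c := (e.symm.image_eq_preimage_symm _).symm
    have h2 : reflectPFL c ⁻¹' (reflectPFL c '' S c) = S c := preimage_image_eq _ e.injective
    change reflectPFL c ⁻¹' _ = _
    rw [preimage_union, h1, h2, union_comm]
  change e z ∈ _ ↔ _
  rw [← mem_preimage, e.preimage_interior, h]

/-! ### The sets `S_k` -/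

/-- `S₁` lies above the pre-folding line, and beyond the line through `L₀` or that through `L₁`. -/
lemma S1_subset {c z : ℂ} (hc : 1 < ‖c‖) (hβ : 0 < c.im) (hz : z ∈ S1 c) :
    -1 ≤ (c * z).im ∧ ((c * z).re ≤ (ell0 c).re ∨ (c ^ 2 * z).re ≤ (ell0 c).re) := by
  have h1 := mul_ell0_re hc
  have h2 := mul_ell0_im hc
  have h3 := neg_one_lt_ell0_im hc hβ
  have hN := one_lt_normSq hc
  rw [S1_eq c hc hβ, mem_ofPred_eq, h2, sq, mul_assoc, mul_re c (c * z), mul_im c (c * z)] at hz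
  rw [sq, mul_assoc, mul_re c (c * z)]
  rw [mul_re] at h1
  rw [mul_im] at h2
  rw [normSq_apply] at hN
  generalize (c * z).re = x at *
  generalize (c * z).im = y at *
  generalize (ell0 c).re = x0 at *
  generalize (ell0 c).im = y0 at *
  rcases hz with ⟨g1, g2, g3⟩ | ⟨g1, g2⟩ | ⟨g1, g2, g3⟩
  · exact ⟨g2, Or.inl g1⟩
  · refine ⟨by linarith, ?_⟩
    by_contra! hcon
    have e1 := mul_pos hβ (sub_pos.2 hcon.1)
    have e2 := mul_nonneg hβ.le (sub_nonneg.2 g1)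
    have hα : c.re ≤ 0 := by
      by_contra! hα
      have := mul_nonneg hα.le (sub_nonneg.2 g1)
      linarith
    have := mul_nonneg (neg_nonneg.2 hα) (sub_nonneg.2 hcon.1.le)
    linarith
  · refine ⟨?_, Or.inr g1⟩
    -- the coordinates relative to `ℓ₀` in the frames `c * z` and `c ^ 2 * z`
    obtain ⟨X, hX⟩ : ∃ X, X = x - x0 := ⟨_, rfl⟩
    obtain ⟨Y, hY⟩ : ∃ Y, Y = y - y0 := ⟨_, rfl⟩
    have e1 : c.re * X - c.im * Y ≤ 0 := by rw [hX, hY]; linarith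
    have e2 : 0 ≤ c.re * Y + c.im * X := by rw [hX, hY]; linarith
    have e3 : c.re * Y + c.im * X ≤ y0 + 1 := by rw [hX, hY]; linarith
    by_contra! hcon
    have e4 : Y < -(y0 + 1) := by linarith
    have e5 : (c.re * c.re + c.im * c.im) * Y =
        c.re * (c.re * Y + c.im * X) - c.im * (c.re * X - c.im * Y) := by ring
    have e6 := mul_nonneg hβ.le (neg_nonneg.2 e1)
    rcases le_total 0 c.re with hα | hα
    · have := mul_nonneg hα e2
      nlinarith
    · have h7 := mul_nonneg (neg_nonneg.2 hα) (sub_nonneg.2 e3)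
      have h8 : 0 < c.re * c.re + c.im * c.im + c.re := by
        rcases le_total (-1) c.re with h | h
        · linarith
        · nlinarith [mul_pos hβ hβ]
      nlinarith [mul_pos h8 (by linarith : 0 < y0 + 1)]

lemma mem_SSeq_iff {c : ℂ} (hc : c ≠ 0) (k : ℕ) (z : ℂ) :
    z ∈ SSeq c k ↔ c ^ k * z ∈ S1 c ∧ ∀ j < k, -1 ≤ (c ^ (j + 1) * z).im := by
  induction k generalizing z with
  | zero => simp [SSeq]
  | succ k ih =>
    have h1 : z ∈ (fun z => z / c) '' SSeq c k ↔ c * z ∈ SSeq c k := by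
      constructor
      · rintro ⟨w, hw, rfl⟩
        rwa [mul_div_cancel₀ _ hc]
      · exact fun h => ⟨c * z, h, by field_simp⟩
    change z ∈ _ ∩ _ ↔ _
    rw [mem_inter_iff, h1, ih, mem_PHPlus_iff, ← mul_assoc, ← pow_succ, and_assoc]
    refine and_congr_right fun _ => ?_
    constructor
    · rintro ⟨h2, h3⟩ j hj
      cases j with
      | zero => simpa using h3
      | succ j =>
        have := h2 j (by omega)
        rwa [← mul_assoc, ← pow_succ] at this
    · intro h2
      refine ⟨fun j hj => ?_, by simpa using h2 0 (by omega)⟩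
      rw [← mul_assoc, ← pow_succ]
      exact h2 (j + 1) (by omega)

lemma neg_one_le_of_mem_S {c z : ℂ} (hc : 1 < ‖c‖) (hβ : 0 < c.im) (hz : z ∈ S c) :
    -1 ≤ (c * z).im := by
  obtain ⟨k, hk⟩ := mem_iUnion.1 hz
  cases k with
  | zero => exact (S1_subset hc hβ hk).1
  | succ k => exact mem_PHPlus_iff.1 hk.2

/-- Strictly above the pre-folding line, the mirror image of `S` plays no role. -/
lemma mem_S_of_neg_one_lt {c z : ℂ} (hc : 1 < ‖c‖) (hβ : 0 < c.im)
    (hz : z ∈ S c ∪ reflectPFL c '' S c) (h : -1 < (c * z).im) : z ∈ S c := by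
  rcases hz with hz | ⟨w, hw, rfl⟩
  · exact hz
  · have := neg_one_le_of_mem_S hc hβ hw
    rw [mul_reflectPFL (ne_zero_of_im_pos hβ), reflectFL_im] at h
    linarith

/-- The points between the folding line and the pre-folding line that lie on the origin sides of
the two lines bounding `f(S₁)` have their preimages above the pre-folding line outside `S ∪ S'`. -/
lemma notMem_of_below_PFL {c z : ℂ} (hc : 1 < ‖c‖) (hβ : 0 < c.im) (h1 : -1 < (c * z).im)
    (h2 : (c ^ 2 * z).im < -1) (h3 : (ell0 c).re < (c * z).re)
    (h4 : (ell0 c).re < (c ^ 2 * z).re) : z ∉ S c ∪ reflectPFL c '' S c := by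
  intro h
  obtain ⟨k, hk⟩ := mem_iUnion.1 (mem_S_of_neg_one_lt hc hβ h h1)
  have hc0 := ne_zero_of_im_pos hβ
  rw [mem_SSeq_iff hc0] at hk
  rcases k with _ | _ | k
  · rw [pow_zero, one_mul] at hk
    rcases (S1_subset hc hβ hk.1).2 with h | h <;> linarith
  · have := (S1_subset hc hβ hk.1).1
    rw [pow_one, ← mul_assoc, ← sq] at this
    linarith
  · linarith [hk.2 1 (by omega)]

/-- A point of `K` above the pre-folding line leaves `S ∪ S'` when it is moved slightly towards
the origin. Membership in `S_k` only involves the orbit under multiplication by `c` while this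
orbit is unfolded; for `z` itself that part of the orbit stays in `K`, hence weakly on the origin
side of the two lines beyond which `S₁` lies, and scaling by `t < 1` makes this strict. -/
lemma exists_forall_smul_notMem {c z : ℂ} (hc : 1 < ‖c‖) (hβ : 0 < c.im) (hz : z ∈ K c)
    (hp : -1 ≤ (c * z).im) :
    ∃ r < (1 : ℝ), ∀ t : ℝ, r < t → t < 1 → 0 < t → (t : ℂ) * z ∉ S c ∪ reflectPFL c '' S c := by
  have hc0 := ne_zero_of_im_pos hβ
  have hx := ell0_re_neg hc hβ
  have him : ∀ (k : ℕ) (t : ℝ), (c ^ k * ((t : ℂ) * z)).im = t * (c ^ k * z).im := by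
    intro k t
    rw [mul_left_comm, im_ofReal_mul]
  have hre : ∀ (k : ℕ) (t : ℝ), (c ^ k * ((t : ℂ) * z)).re = t * (c ^ k * z).re := by
    intro k t
    rw [mul_left_comm, re_ofReal_mul]
  -- no `S_{k+1}` can contain `t * z` before the unfolded orbit of `z` crosses the folding line
  have main : ∀ (k : ℕ) (t : ℝ), t < 1 → 0 < t → (∀ j ≤ k, -1 ≤ (c ^ (j + 1) * z).im) →
      (t : ℂ) * z ∉ SSeq c k := by
    intro k t ht ht0 h hmem
    have hu : c ^ k * z ∈ K c := (pow_mul_mem_K_iff fun j hj => h j hj.le).2 hz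
    have h1 := ell0_re_le_mul_of_mem_K hc hβ hu
    have h2 := ell0_re_le_mul_of_mem_K hc hβ (f_mem_K_iff.2 hu)
    have e : c * (c ^ k * z) = c ^ (k + 1) * z := by rw [← mul_assoc, ← pow_succ']
    have e2 : c * (c ^ (k + 1) * z) = c ^ (k + 2) * z := by rw [← mul_assoc, ← pow_succ']
    rw [f_of_le (by rw [e]; exact h k le_rfl), e, e2] at h2
    rw [e] at h1
    rw [mem_SSeq_iff hc0] at hmem
    have h3 := (S1_subset hc hβ hmem.1).2
    rw [← mul_assoc c, ← mul_assoc (c ^ 2), ← pow_succ', ← pow_add, add_comm 2 k, hre, hre] at h3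
    rcases h3 with h3 | h3 <;> nlinarith
  have hS' : ∀ t : ℝ, t < 1 → 0 < t → (t : ℂ) * z ∈ S c ∪ reflectPFL c '' S c →
      (t : ℂ) * z ∈ S c := by
    intro t ht ht0 h
    refine mem_S_of_neg_one_lt hc hβ h ?_
    have := him 1 t
    rw [pow_one] at this
    rw [this]
    nlinarith
  by_cases hall : ∀ j : ℕ, -1 ≤ (c ^ (j + 1) * z).im
  · refine ⟨0, one_pos, fun t _ ht ht0 h => ?_⟩
    obtain ⟨k, hk⟩ := mem_iUnion.1 (hS' t ht ht0 h)
    exact main k t ht ht0 (fun j _ => hall j) hk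
  · push Not at hall
    classical
    obtain ⟨J, hJ, hmin⟩ : ∃ J : ℕ, (c ^ (J + 1) * z).im < -1 ∧
        ∀ j < J, -1 ≤ (c ^ (j + 1) * z).im :=
      ⟨Nat.find hall, Nat.find_spec hall, fun j hj => not_lt.1 (Nat.find_min hall hj)⟩
    refine ⟨-1 / (c ^ (J + 1) * z).im, ?_, fun t hr ht ht0 h => ?_⟩
    · rw [div_lt_iff_of_neg (by linarith)]
      linarith
    · rw [div_lt_iff_of_neg (by linarith), ← him] at hr
      obtain ⟨k, hk⟩ := mem_iUnion.1 (hS' t ht ht0 h)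
      rcases lt_or_ge k J with hkJ | hkJ
      · exact main k t ht ht0 (fun j hj => hmin j (by omega)) hk
      · rw [mem_SSeq_iff hc0] at hk
        rcases hkJ.lt_or_eq with hkJ | rfl
        · linarith [hk.2 J hkJ]
        · have := (S1_subset hc hβ hk.1).1
          rw [← mul_assoc, ← pow_succ'] at this
          linarith

lemma K_subset_P {c : ℂ} (hc : 1 < ‖c‖) (hβ : 0 < c.im) : K c ⊆ P c := by
  have hc0 := ne_zero_of_im_pos hβ
  have main : ∀ z ∈ K c, -1 ≤ (c * z).im → z ∈ P c := by
    intro z hz hp hint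
    obtain ⟨r, hr, h⟩ := exists_forall_smul_notMem hc hβ hz hp
    have hcont : Tendsto (fun t : ℝ => (t : ℂ) * z) (𝓝[<] 1) (𝓝 z) := by
      have : Continuous fun t : ℝ => (t : ℂ) * z := by fun_prop
      simpa using (this.tendsto 1).mono_left nhdsWithin_le_nhds
    have e1 := hcont.eventually (isOpen_interior.mem_nhds hint)
    have e2 : ∀ᶠ t : ℝ in 𝓝[<] 1, t < 1 := self_mem_nhdsWithin
    have e3 : ∀ᶠ t : ℝ in 𝓝[<] 1, r < t := nhdsWithin_le_nhds (lt_mem_nhds hr)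
    have e4 : ∀ᶠ t : ℝ in 𝓝[<] 1, 0 < t := nhdsWithin_le_nhds (lt_mem_nhds one_pos)
    obtain ⟨t, g1, g2, g3, g4⟩ := (e1.and (e2.and (e3.and e4))).exists
    exact h t g3 g2 g4 (interior_subset g1)
  intro z hz
  rcases le_total (-1) (c * z).im with h | h
  · exact main z hz h
  · intro hint
    refine main (reflectPFL c z) ?_ ?_ ((reflectPFL_mem_interior_iff hc0 z).2 hint)
    · rwa [← f_mem_K_iff, f_reflectPFL hc0, f_mem_K_iff]
    · rw [mul_reflectPFL hc0, reflectFL_im]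
      linarith

/-! ### The spiral of vertices -/

/-- The vertices `ℓ₀ / c ^ k`, which are the points `ℓ_k` for natural numbers `k`. -/
noncomputable def vertex (c : ℂ) (k : ℕ) : ℂ := ell0 c / c ^ k

lemma vertex_zero (c : ℂ) : vertex c 0 = ell0 c := by simp [vertex]

lemma pow_mul_vertex_add {c : ℂ} (hc : c ≠ 0) (j k : ℕ) :
    c ^ j * vertex c (k + j) = vertex c k := by
  unfold vertex
  field_simp
  ring

lemma mul_vertex_succ {c : ℂ} (hc : c ≠ 0) (k : ℕ) : c * vertex c (k + 1) = vertex c k := by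
  simpa using pow_mul_vertex_add hc 1 k

lemma pow_mul_vertex {c : ℂ} (hc : c ≠ 0) (k : ℕ) : c ^ k * vertex c k = ell0 c := by
  simpa [vertex_zero] using pow_mul_vertex_add hc k 0

lemma ell_natCast (c : ℂ) (k : ℕ) : ell c k = vertex c k := by
  simp [ell, vertex]

lemma reflectFL_ell0 {c : ℂ} (hc : 1 < ‖c‖) : reflectFL (ell0 c) = c * ell0 c := by
  apply Complex.ext
  · rw [reflectFL_re, mul_ell0_re hc]
  · rw [reflectFL_im, mul_ell0_im hc]

lemma ell_one_sub {c : ℂ} (hc : 1 < ‖c‖) (hβ : 0 < c.im) (k : ℕ) :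
    ell c (1 - k) = reflectPFL c (vertex c k) := by
  have hc0 := ne_zero_of_im_pos hβ
  rcases k with _ | _ | k
  · apply mul_left_cancel₀ hc0
    have := ell_natCast c 1
    rw [mul_reflectPFL hc0, vertex_zero, ← reflectFL_ell0 hc, reflectFL_reflectFL]
    simp only [Nat.cast_one] at this
    simp only [Nat.cast_zero, sub_zero, this]
    rw [mul_vertex_succ hc0, vertex_zero]
  · have := ell_natCast c 0
    simp only [Nat.cast_zero] at this
    simp only [zero_add, Nat.cast_one, sub_self, this]
    apply mul_left_cancel₀ hc0
    rw [mul_reflectPFL hc0, mul_vertex_succ hc0, vertex_zero, reflectFL_ell0 hc]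
  · rw [ell, if_neg (by push_cast; omega), sub_sub_cancel, zpow_natCast]
    rfl

lemma vertex_mem_K {c : ℂ} (hc : 1 < ‖c‖) (hβ : 0 < c.im) {k : ℕ}
    (h : ∀ j < k, -1 ≤ (vertex c j).im) : vertex c k ∈ K c := by
  have hc0 := ne_zero_of_im_pos hβ
  induction k with
  | zero => rw [vertex_zero]; exact ell0_mem_K hc hβ
  | succ k ih =>
    rw [← f_mem_K_iff, f_of_le (by rw [mul_vertex_succ hc0]; exact h k (by omega)),
      mul_vertex_succ hc0]
    exact ih fun j hj => h j (by omega)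

lemma pow_succ_re (c : ℂ) (k : ℕ) :
    (c ^ (k + 1)).re = c.re * (c ^ k).re - c.im * (c ^ k).im := by
  rw [pow_succ', mul_re]

lemma pow_succ_im (c : ℂ) (k : ℕ) :
    (c ^ (k + 1)).im = c.re * (c ^ k).im + c.im * (c ^ k).re := by
  rw [pow_succ', mul_im]

/-- The vertices in terms of `c ^ k`. -/
lemma normSq_pow_mul_vertex {c : ℂ} (hc : c ≠ 0) (k : ℕ) :
    (normSq (c ^ k) : ℂ) * vertex c k = (starRingEnd ℂ) (c ^ k) * ell0 c := by
  rw [normSq_eq_conj_mul_self, mul_assoc, pow_mul_vertex hc]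

/-- `ℓ_k` as a combination of `c ℓ₀` and `ℓ₀`; the coefficients are those of `conj c ^ k` with
respect to the basis `c, 1` of `ℂ` over `ℝ`. -/
lemma vertex_eq_combination {c : ℂ} (hβ : 0 < c.im) (k : ℕ) :
    vertex c k = ((-(c ^ k).im / (c.im * normSq (c ^ k)) : ℝ) : ℂ) * (c * ell0 c) +
      (((c ^ (k + 1)).im / (c.im * normSq (c ^ k)) : ℝ) : ℂ) * ell0 c := by
  have hc0 := ne_zero_of_im_pos hβ
  have hN : (normSq (c ^ k) : ℂ) ≠ 0 := by
    rw [ofReal_ne_zero, Ne, map_eq_zero]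
    exact pow_ne_zero _ hc0
  have hb : (c.im : ℂ) ≠ 0 := ofReal_ne_zero.2 hβ.ne'
  apply mul_left_cancel₀ hN
  rw [normSq_pow_mul_vertex hc0]
  have : (c.im : ℂ) * (starRingEnd ℂ) (c ^ k) = -((c ^ k).im : ℂ) * c + ((c ^ (k + 1)).im : ℂ) := by
    rw [pow_succ_im]
    apply Complex.ext <;> simp [-map_pow]
    · ring
    · ring
  push_cast
  field_simp
  linear_combination ell0 c * this

/-- The part of "`ζ` exists with index `n`" that concerns the heights of the vertices. -/
structure FirstCrossing (c : ℂ) (n : ℕ) : Prop where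
  pos : 1 ≤ n
  above : ∀ k < n, -1 < (vertex c k).im
  below : (vertex c n).im ≤ -1

/-- If `ℓ_m` lies in the triangle with corners `0`, `c ℓ₀`, `ℓ₀`, then every later vertex is a
sub-convex combination of two earlier ones and so stays above the folding line. -/
lemma FirstCrossing.not_combination {c : ℂ} {n m : ℕ} (h : FirstCrossing c n) (hc0 : c ≠ 0)
    (hm : 1 ≤ m) (hmn : m < n) {σ τ : ℝ} (hσ : 0 ≤ σ) (hτ : 0 ≤ τ) (hστ : σ + τ ≤ 1)
    (e : vertex c m = σ * (c * ell0 c) + τ * ell0 c) : False := by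
  have hstep : ∀ i, vertex c (i + 1 + m) = σ * vertex c i + τ * vertex c (i + 1) := by
    intro i
    have h1 : c ^ (i + 1) * vertex c (i + 1 + m) = vertex c m := by
      rw [add_comm (i + 1) m, pow_mul_vertex_add hc0]
    have h2 : c ^ (i + 1) * vertex c i = c * ell0 c := by
      rw [pow_succ', mul_assoc, pow_mul_vertex hc0]
    apply mul_left_cancel₀ (pow_ne_zero (i + 1) hc0)
    rw [h1, e]
    linear_combination (-(σ : ℂ)) * h2 - (τ : ℂ) * pow_mul_vertex hc0 (i + 1)
  have all : ∀ k, -1 < (vertex c k).im := by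
    intro k
    induction k using Nat.strong_induction_on with
    | _ k ih =>
      rcases lt_or_ge k n with hk | hk
      · exact h.above k hk
      · obtain ⟨i, rfl⟩ : ∃ i, k = i + 1 + m := ⟨k - 1 - m, by omega⟩
        have h1 := ih i (by omega)
        have h2 := ih (i + 1) (by omega)
        rw [hstep, add_im, im_ofReal_mul, im_ofReal_mul]
        rcases hσ.lt_or_eq with hσ | rfl
        · nlinarith
        · rcases hτ.lt_or_eq with hτ | rfl
          · nlinarith
          · norm_num
  linarith [all n, h.below]

namespace FirstCrossing

variable {c : ℂ} {n : ℕ}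

lemma vertex_mem_K (h : FirstCrossing c n) (hc : 1 < ‖c‖) (hβ : 0 < c.im) {k : ℕ} (hk : k ≤ n) :
    vertex c k ∈ K c :=
  TwistedTent.vertex_mem_K hc hβ fun j hj => (h.above j (by omega)).le

/-- The spiral makes less than one full turn before it crosses the folding line: the vertices
`ℓ_m`, `1 ≤ m < n`, avoid the triangle with corners `0`, `c ℓ₀`, `ℓ₀`, and since they lie to the
right of the line through `c ℓ₀` and `ℓ₀`, they avoid the angle which it spans. -/
lemma pow_im_neg (h : FirstCrossing c n) (hc : 1 < ‖c‖) (hβ : 0 < c.im) {m : ℕ}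
    (hm : 1 ≤ m) (hmn : m < n) (hb : (c ^ m).im ≤ 0) : (c ^ (m + 1)).im < 0 := by
  by_contra! hb'
  have hc0 := ne_zero_of_im_pos hβ
  have hN : 0 < normSq (c ^ m) := normSq_pos.2 (pow_ne_zero _ hc0)
  have e := vertex_eq_combination hβ m
  have hσ : 0 ≤ -(c ^ m).im / (c.im * normSq (c ^ m)) := div_nonneg (by linarith) (by positivity)
  have hτ : 0 ≤ (c ^ (m + 1)).im / (c.im * normSq (c ^ m)) := div_nonneg hb' (by positivity)
  refine h.not_combination hc0 hm hmn hσ hτ ?_ e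
  have h1 := ell0_re_le_of_mem_K hc hβ (h.vertex_mem_K hc hβ hmn.le)
  have hx := ell0_re_neg hc hβ
  rw [e, add_re, re_ofReal_mul, re_ofReal_mul, mul_ell0_re hc] at h1
  nlinarith

lemma ell0_re_lt_vertex_re (h : FirstCrossing c n) (hc : 1 < ‖c‖) (hβ : 0 < c.im) {m : ℕ}
    (hm : 1 ≤ m) (hmn : m < n) : (ell0 c).re < (vertex c m).re := by
  have hc0 := ne_zero_of_im_pos hβ
  have hK := h.vertex_mem_K hc hβ hmn.le
  have hx := ell0_re_neg hc hβ
  have hy := neg_one_lt_ell0_im hc hβ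
  have e := vertex_eq_combination hβ m
  refine (ell0_re_le_of_mem_K hc hβ hK).lt_of_ne fun heq => ?_
  have h1 := ell0_re_le_mul_of_mem_K hc hβ hK
  have h2 := h.above m hmn
  generalize -(c ^ m).im / (c.im * normSq (c ^ m)) = σ at e
  generalize (c ^ (m + 1)).im / (c.im * normSq (c ^ m)) = τ at e
  have h3 := mul_ell0_re hc
  have h4 := mul_ell0_im hc
  have hst : σ + τ = 1 := by
    rw [e, add_re, re_ofReal_mul, re_ofReal_mul, h3] at heq
    have : (σ + τ - 1) * (ell0 c).re = 0 := by linarith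
    rcases mul_eq_zero.1 this with h | h <;> linarith
  have hσ : 0 ≤ σ := by
    rw [e, mul_re, add_re, add_im, re_ofReal_mul, re_ofReal_mul, im_ofReal_mul, im_ofReal_mul,
      h3, h4] at h1
    rw [mul_re] at h3
    obtain rfl : τ = 1 - σ := by linarith
    by_contra! hneg
    nlinarith [mul_pos (mul_pos hβ (neg_pos.2 hneg)) (by linarith : 0 < (ell0 c).im + 1)]
  have hτ : 0 ≤ τ := by
    rw [e, add_im, im_ofReal_mul, im_ofReal_mul, h4] at h2
    obtain rfl : σ = 1 - τ := by linarith
    by_contra! hneg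
    nlinarith
  exact h.not_combination hc0 hm hmn hσ hτ hst.le e

/-- `L_n` crosses the pre-folding line downwards. -/
lemma pow_re_neg (h : FirstCrossing c n) (hc : 1 < ‖c‖) (hβ : 0 < c.im) : (c ^ n).re < 0 := by
  have hc0 := ne_zero_of_im_pos hβ
  obtain ⟨m, rfl⟩ : ∃ m, n = m + 1 := ⟨n - 1, by have := h.pos; omega⟩
  have h1 := h.above m (by omega)
  have h2 := h.below
  have e1 := normSq_pow_mul_vertex hc0 (m + 1)
  have hN : 0 < normSq (c ^ (m + 1)) := normSq_pos.2 (pow_ne_zero _ hc0)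
  have e2 : (normSq (c ^ (m + 1)) : ℂ) * vertex c m =
      (starRingEnd ℂ) (c ^ (m + 1)) * (c * ell0 c) := by
    rw [← mul_vertex_succ hc0 m, mul_left_comm, e1]
    ring
  have g3 := congrArg im e1
  have g4 := congrArg im e2
  rw [im_ofReal_mul, mul_im, conj_re, conj_im] at g3 g4
  rw [mul_ell0_re hc, mul_ell0_im hc] at g4
  have hy := neg_one_lt_ell0_im hc hβ
  by_contra! hcon
  have := mul_pos hN (by linarith : 0 < (vertex c m).im - (vertex c (m + 1)).im)
  nlinarith [mul_nonneg hcon (by linarith : 0 ≤ (ell0 c).im + 1)]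

/-- The condition `Im ℓ_n ≤ -1` in terms of `c ^ n`. -/
lemma pow_le_of_below (h : FirstCrossing c n) (hc : 1 < ‖c‖) (hβ : 0 < c.im) :
    2 * (1 - c.re) * (c ^ n).re + 2 * c.im * (c ^ n).im ≤ -((normSq c - 1) * normSq (c ^ n)) := by
  have hc0 := ne_zero_of_im_pos hβ
  have hN : 0 < normSq (c ^ n) := normSq_pos.2 (pow_ne_zero _ hc0)
  have g := congrArg im (normSq_pow_mul_vertex hc0 n)
  rw [im_ofReal_mul, mul_im, conj_re, conj_im] at g
  have h1 := normSq_sub_one_mul_ell0_re hc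
  have h2 := normSq_sub_one_mul_ell0_im hc
  have h3 := one_lt_normSq hc
  have h4 := h.below
  have h5 := mul_le_mul_of_nonneg_left h4 (mul_nonneg (by linarith : 0 ≤ normSq c - 1) hN.le)
  have h6 : (normSq c - 1) * normSq (c ^ n) * (vertex c n).im =
      2 * (1 - c.re) * (c ^ n).re + 2 * c.im * (c ^ n).im := by
    rw [mul_assoc, g]
    linear_combination (c ^ n).re * h2 - (c ^ n).im * h1
  linarith

/-- The orbit of `γ₀` under multiplication by `c` stays above the folding line for `n` steps.
Its heights change by `|c - 1|² / β` times the imaginary part of `c ^ j`, which is positive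
first and then negative, so that only the first and the last height matter. -/
lemma pow_im_sub_le (h : FirstCrossing c n) (hc : 1 < ‖c‖) (hβ : 0 < c.im) {j : ℕ} (hj : j < n) :
    (c ^ (j + 1)).im - normSq c * (c ^ j).im ≤ c.im := by
  obtain ⟨B, hB⟩ : ∃ B : ℕ → ℝ, ∀ j, B j = (c ^ (j + 1)).im - normSq c * (c ^ j).im :=
    ⟨_, fun _ => rfl⟩
  have hstep : ∀ j, B (j + 1) = B j - normSq (c - 1) * (c ^ (j + 1)).im := by
    intro j
    have e1 := pow_succ_im c (j + 1)
    have e2 := pow_succ_re c j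
    have e3 := pow_succ_im c j
    rw [hB, hB, e1]
    simp only [normSq_apply, sub_re, sub_im, one_re, one_im, sub_zero]
    rw [e2, e3]
    ring
  have hnn : 0 ≤ normSq (c - 1) := normSq_nonneg _
  have hup : ∀ j, (∀ i < j, 0 < (c ^ (i + 1)).im) → B j ≤ c.im := by
    intro j
    induction j with
    | zero => intro _; simp [hB]
    | succ j ih =>
      intro hpos
      rw [hstep]
      have := mul_nonneg hnn (hpos j (by omega)).le
      linarith [ih fun i hi => hpos i (by omega)]
  obtain ⟨m, rfl⟩ : ∃ m, n = m + 1 := ⟨n - 1, by omega⟩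
  have hneg : ∀ i k, (c ^ (i + 1)).im ≤ 0 → i + k ≤ m → (c ^ (i + k + 1)).im ≤ 0 := by
    intro i k hi
    induction k with
    | zero => intro _; exact hi
    | succ k ih =>
      intro hk
      exact (h.pow_im_neg hc hβ (by omega) (by omega) (ih (by omega))).le
  have hlast : B m ≤ c.im := by
    rcases le_or_gt (c ^ (m + 1)).im 0 with hb | hb
    · have e := h.pow_le_of_below hc hβ
      have ha := h.pow_re_neg hc hβ
      have e1 : B m = (c ^ (m + 1)).re * c.im + (c ^ (m + 1)).im * (1 - c.re) := by
        rw [hB, pow_succ_re, pow_succ_im, normSq_apply]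
        ring
      rw [e1]
      rw [normSq_apply (c ^ (m + 1)), normSq_apply c] at e
      generalize (c ^ (m + 1)).re = p at *
      generalize (c ^ (m + 1)).im = q at *
      rcases le_or_gt c.re 1 with hα | hα
      · nlinarith [mul_nonneg (neg_nonneg.2 hb) (sub_nonneg.2 hα), mul_pos (neg_pos.2 ha) hβ]
      · rcases hb.lt_or_eq with hb | rfl
        · have e2 : q * q * (c.re - 1) ≤ -q * c.im := by
            have t1 := mul_pos (neg_pos.2 ha) (sub_pos.2 hα)
            have t2 : 0 < c.re * c.re + c.im * c.im - 1 := by nlinarith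
            have t3 := mul_nonneg (mul_self_nonneg p) t2.le
            have t4 : 2 * (c.re - 1) ≤ c.re * c.re + c.im * c.im - 1 := by
              nlinarith [mul_self_nonneg (c.re - 1), mul_self_nonneg c.im]
            have t5 := mul_le_mul_of_nonneg_left t4 (mul_self_nonneg q)
            linarith
          have e3 : -q * (c.re - 1) ≤ c.im := by
            have : 0 < -q := by linarith
            by_contra! hcon
            nlinarith
          nlinarith [mul_pos (neg_pos.2 ha) hβ]
        · nlinarith [mul_pos (neg_pos.2 ha) hβ]
    · refine hup m fun i hi => ?_
      by_contra! hcon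
      have := hneg i (m - i) hcon (by omega)
      rw [show i + (m - i) + 1 = m + 1 by omega] at this
      linarith
  rw [← hB]
  by_cases hpos : ∀ i < j, 0 < (c ^ (i + 1)).im
  · exact hup j hpos
  · push Not at hpos
    obtain ⟨i, hij, hi⟩ := hpos
    have hmono : ∀ k, j + k ≤ m → B j ≤ B (j + k) := by
      intro k
      induction k with
      | zero => intro _; exact le_rfl
      | succ k ih =>
        intro hk
        have h1 := hneg i (j + k - i) hi (by omega)
        rw [show i + (j + k - i) + 1 = j + k + 1 by omega] at h1
        have h2 := hstep (j + k)
        have h3 := mul_nonneg hnn (neg_nonneg.2 h1)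
        have h4 := ih (by omega)
        rw [← add_assoc, h2]
        linarith
    have := hmono (m - j) (by omega)
    rw [show j + (m - j) = m by omega] at this
    exact this.trans hlast

end FirstCrossing

/-! ### The crossing point `ζ` -/

/-- The point that divides the segment from `ℓ_n` to `ℓ_{n+1}` in the ratio `s : 1 - s`. -/
noncomputable def edgePoint (c : ℂ) (n : ℕ) (s : ℝ) : ℂ :=
  (1 - s) * vertex c n + s * vertex c (n + 1)

lemma edgePoint_re (c : ℂ) (n : ℕ) (s : ℝ) :
    (edgePoint c n s).re = (1 - s) * (vertex c n).re + s * (vertex c (n + 1)).re := by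
  simp [edgePoint]

lemma edgePoint_im (c : ℂ) (n : ℕ) (s : ℝ) :
    (edgePoint c n s).im = (1 - s) * (vertex c n).im + s * (vertex c (n + 1)).im := by
  simp [edgePoint]

lemma pow_mul_edgePoint_add {c : ℂ} (hc : c ≠ 0) (j k : ℕ) (s : ℝ) :
    c ^ j * edgePoint c (k + j) s = edgePoint c k s := by
  unfold edgePoint
  rw [mul_add, mul_left_comm, pow_mul_vertex_add hc, mul_left_comm,
    show k + j + 1 = k + 1 + j by ring, pow_mul_vertex_add hc]

lemma pow_succ_mul_edgePoint {c : ℂ} (hc : c ≠ 0) (k : ℕ) (s : ℝ) :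
    c ^ (k + 1) * edgePoint c k s = (1 - s) * (c * ell0 c) + s * ell0 c := by
  have h1 : c ^ (k + 1) * vertex c k = c * ell0 c := by
    rw [pow_succ', mul_assoc, pow_mul_vertex hc]
  unfold edgePoint
  linear_combination (1 - (s : ℂ)) * h1 + (s : ℂ) * pow_mul_vertex hc (k + 1)

lemma pow_succ_mul_edgePoint_re {c : ℂ} (hc : 1 < ‖c‖) (hβ : 0 < c.im) (k : ℕ) (s : ℝ) :
    (c ^ (k + 1) * edgePoint c k s).re = (ell0 c).re := by
  have h := mul_ell0_re hc
  rw [pow_succ_mul_edgePoint (ne_zero_of_im_pos hβ)]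
  generalize c * ell0 c = w at *
  simp
  rw [h]
  ring

lemma pow_succ_mul_edgePoint_im {c : ℂ} (hc : 1 < ‖c‖) (hβ : 0 < c.im) (k : ℕ) (s : ℝ) :
    (c ^ (k + 1) * edgePoint c k s).im =
      -2 - (ell0 c).im + 2 * s * ((ell0 c).im + 1) := by
  have h := mul_ell0_im hc
  rw [pow_succ_mul_edgePoint (ne_zero_of_im_pos hβ)]
  generalize c * ell0 c = w at *
  simp
  rw [h]
  ring

lemma mem_segment_vertex_iff {c z : ℂ} {n : ℕ} :
    z ∈ segment ℝ (vertex c n) (vertex c (n + 1)) ↔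
      ∃ s : ℝ, 0 ≤ s ∧ s ≤ 1 ∧ z = edgePoint c n s := by
  rw [segment_eq_image]
  constructor
  · rintro ⟨s, ⟨h0, h1⟩, rfl⟩
    exact ⟨s, h0, h1, by simp [edgePoint]⟩
  · rintro ⟨s, h0, h1, rfl⟩
    exact ⟨s, ⟨h0, h1⟩, by simp [edgePoint]⟩

lemma L_natCast (c : ℂ) (n : ℕ) : L c n = segment ℝ (vertex c n) (vertex c (n + 1)) := by
  have := ell_natCast c (n + 1)
  push_cast at this
  rw [L, ell_natCast, this]

lemma mul_edgePoint_succ {c : ℂ} (hc : c ≠ 0) (k : ℕ) (s : ℝ) :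
    c * edgePoint c (k + 1) s = edgePoint c k s := by
  simpa using pow_mul_edgePoint_add hc 1 k s

lemma IsZeta.firstCrossing {c ζ : ℂ} {n : ℤ} (h : IsZeta c n ζ) (hc : 1 < ‖c‖) (hβ : 0 < c.im) :
    ∃ m : ℕ, n = m ∧ FirstCrossing c m ∧ ∃ s : ℝ, 0 < s ∧ s ≤ 1 ∧ ζ = edgePoint c m s ∧
      (c * ζ).im = -1 := by
  obtain ⟨⟨⟨hpos, -⟩, hmin⟩, hζ⟩ := h
  have hc0 := ne_zero_of_im_pos hβ
  lift n to ℕ using hpos.le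
  have hn : 0 < n := by exact_mod_cast hpos
  have habove : ∀ k < n, -1 < (vertex c k).im := by
    intro k
    induction k with
    | zero => intro _; rw [vertex_zero]; exact neg_one_lt_ell0_im hc hβ
    | succ k ih =>
      intro hk
      have h1 := ih (by omega)
      by_contra! hcon
      have hd : 0 < (vertex c k).im - (vertex c (k + 1)).im := by linarith
      obtain ⟨s, hs⟩ : ∃ s, s = ((vertex c k).im + 1) / ((vertex c k).im - (vertex c (k + 1)).im) :=
        ⟨_, rfl⟩
      have hs' : s * ((vertex c k).im - (vertex c (k + 1)).im) = (vertex c k).im + 1 := by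
        rw [hs, div_mul_cancel₀ _ hd.ne']
      have hs0 : 0 ≤ s := by rw [hs]; exact div_nonneg (by linarith) hd.le
      have hs1 : s ≤ 1 := by rw [hs, div_le_one hd]; linarith
      have hmem : ((k + 1 : ℕ) : ℤ) ∈ {j : ℤ | 0 < j ∧ (L c j ∩ PFL c).Nonempty} := by
        refine ⟨by positivity, edgePoint c (k + 1) s, ?_, ?_⟩
        · rw [L_natCast, mem_segment_vertex_iff]
          exact ⟨s, hs0, hs1, rfl⟩
        · rw [mem_PFL_iff, mul_edgePoint_succ hc0, edgePoint_im]
          linarith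
      have := hmin hmem
      have : n ≤ k + 1 := by exact_mod_cast this
      omega
  have hmem : ζ ∈ L c n ∩ PFL c := hζ ▸ mem_singleton ζ
  rw [L_natCast, mem_inter_iff, mem_segment_vertex_iff, mem_PFL_iff] at hmem
  obtain ⟨⟨s, hs0, hs1, hs⟩, him⟩ := hmem
  have e := him
  obtain ⟨m, rfl⟩ : ∃ m, n = m + 1 := ⟨n - 1, by omega⟩
  rw [hs, mul_edgePoint_succ hc0, edgePoint_im] at e
  have h1 := habove m (by omega)
  have hs0' : 0 < s := by
    refine hs0.lt_of_ne ?_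
    rintro rfl
    linarith
  refine ⟨m + 1, rfl, ⟨hn, habove, ?_⟩, s, hs0', hs1, hs, him⟩
  by_contra! hcon
  nlinarith

/-! ### The point `γ₀` escapes -/

lemma mul_pow_mul_gamma0_im {c : ℂ} (hβ : 0 < c.im) (j : ℕ) :
    c.im * (c ^ (j + 1) * gamma0 c).im = normSq c * (c ^ j).im - (c ^ (j + 1)).im := by
  have h : (gamma0 c).re * c.im = c.re - 1 := by
    simp [gamma0]
    field_simp
  have h' : (gamma0 c).im = -1 := by simp [gamma0]
  rw [mul_im, h', pow_succ_re, pow_succ_im, normSq_apply]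
  linear_combination (c.re * (c ^ j).im + c.im * (c ^ j).re) * h

/-- Unfolded points beyond the line through `L_n` escape. -/
lemma notMem_K_of_pow_mul_re_lt {c z : ℂ} {n : ℕ} (hc : 1 < ‖c‖) (hβ : 0 < c.im)
    (h : ∀ j < n, -1 ≤ (c ^ (j + 1) * z).im) (hz : (c ^ (n + 1) * z).re < (ell0 c).re) :
    z ∉ K c := by
  intro hK
  have := ell0_re_le_mul_of_mem_K hc hβ ((pow_mul_mem_K_iff h).2 hK)
  rw [← mul_assoc, ← pow_succ'] at this
  linarith

lemma FirstCrossing.gamma0_notMem_K {c : ℂ} {n : ℕ} (h : FirstCrossing c n) (hc : 1 < ‖c‖)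
    (hβ : 0 < c.im) {s : ℝ} (hs : (c * edgePoint c n s).im = -1)
    (him : -1 < (edgePoint c n s).im) : gamma0 c ∉ K c := by
  refine notMem_K_of_pow_mul_re_lt (n := n) hc hβ (fun j hj => ?_) ?_
  · have h1 := h.pow_im_sub_le hc hβ hj
    have h2 := mul_pow_mul_gamma0_im hβ j
    by_contra! hcon
    nlinarith
  · -- `γ₀` lies on the pre-folding line beyond `ζ`, on the outer side of the line through `L_n`
    have hγ : (c * gamma0 c).im = -1 := by
      have := mul_pow_mul_gamma0_im hβ 0
      rw [zero_add, pow_one, pow_zero, one_im, mul_zero, zero_sub] at this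
      apply mul_left_cancel₀ hβ.ne'
      linarith
    have hγ' : (gamma0 c).im = -1 := by simp [gamma0]
    have e := pow_succ_mul_edgePoint_re hc hβ n s
    have ha := h.pow_re_neg hc hβ
    generalize edgePoint c n s = ζ at *
    have e1 : normSq c * ((gamma0 c).im - ζ.im) =
        c.re * ((c * gamma0 c).im - (c * ζ).im) - c.im * ((c * gamma0 c).re - (c * ζ).re) := by
      simp only [mul_re, mul_im, normSq_apply]
      ring
    rw [hγ, hs, hγ', sub_self, mul_zero, zero_sub] at e1
    have hN := one_lt_normSq hc
    have e2 : 0 < (c * gamma0 c).re - (c * ζ).re := by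
      have := mul_pos (by linarith : 0 < normSq c) (by linarith : 0 < ζ.im + 1)
      by_contra! hcon
      nlinarith
    rw [pow_succ, mul_assoc, mul_re, hs] at e
    rw [pow_succ, mul_assoc, mul_re, hγ]
    nlinarith

/-! ### The region beyond `L_n` near `ζ` -/

/-- The open set of points strictly beyond `L_n` (in the strip perpendicular to `L_n`), strictly
above the folding line and the pre-folding line, unfolded for `n` steps, and strictly on the
origin side of the lines through `c L₀, L₀, …, L_{n-1}`. -/
def cap (c : ℂ) (n : ℕ) : Set ℂ :=
  {z | -1 < z.im ∧ (∀ j < n, -1 < (c ^ (j + 1) * z).im) ∧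
    (c ^ (n + 1) * z).re < (ell0 c).re ∧
    -2 - (ell0 c).im < (c ^ (n + 1) * z).im ∧ (c ^ (n + 1) * z).im < (ell0 c).im ∧
    ∀ k ≤ n, (ell0 c).re < (c ^ k * z).re}

lemma isOpen_forall_lt {P : ℕ → Prop} {n : ℕ} (hP : ∀ k, P k → k ≤ n) {a : ℝ} {g : ℕ → ℂ → ℝ}
    (hg : ∀ k, Continuous (g k)) : IsOpen {z | ∀ k, P k → a < g k z} := by
  have : {z | ∀ k, P k → a < g k z} = ⋂ k ∈ {k | P k}, {z | a < g k z} := by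
    ext z
    simp
  rw [this]
  exact ((finite_Iic n).subset hP).isOpen_biInter fun k _ => isOpen_lt continuous_const (hg k)

lemma isOpen_cap (c : ℂ) (n : ℕ) : IsOpen (cap c n) := by
  unfold cap
  refine IsOpen.and ?_ (IsOpen.and ?_ (IsOpen.and ?_ (IsOpen.and ?_ (IsOpen.and ?_ ?_))))
  · exact isOpen_lt (by fun_prop) (by fun_prop)
  · exact isOpen_forall_lt (n := n) (fun k hk => le_of_lt hk) fun k => by fun_prop
  · exact isOpen_lt (by fun_prop) (by fun_prop)
  · exact isOpen_lt (by fun_prop) (by fun_prop)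
  · exact isOpen_lt (by fun_prop) (by fun_prop)
  · exact isOpen_forall_lt (fun k hk => hk) fun k => by fun_prop

lemma cap_subset_S {c : ℂ} {n : ℕ} (hc : 1 < ‖c‖) (hβ : 0 < c.im) (hn : 1 ≤ n) :
    cap c n ⊆ S c := by
  rintro z ⟨-, h1, h2, h3, h4, -⟩
  obtain ⟨m, rfl⟩ : ∃ m, n = m + 1 := ⟨n - 1, by omega⟩
  have hc0 := ne_zero_of_im_pos hβ
  -- the two halves of the strip beyond `L_n` belong to `S_n` and `S_{n+1}`
  rcases le_total (c ^ (m + 1 + 1) * z).im (-1) with h | h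
  · refine mem_iUnion.2 ⟨m, (mem_SSeq_iff hc0 _ _).2 ⟨?_, fun j hj => (h1 j (by omega)).le⟩⟩
    rw [S1_eq c hc hβ]
    right; right
    have e : c ^ 2 * (c ^ m * z) = c ^ (m + 1 + 1) * z := by ring
    rw [e, mul_ell0_im hc]
    exact ⟨h2.le, h3.le, h⟩
  · refine mem_iUnion.2 ⟨m + 1, (mem_SSeq_iff hc0 _ _).2 ⟨?_, fun j hj => (h1 j hj).le⟩⟩
    rw [S1_eq c hc hβ]
    left
    have e : c * (c ^ (m + 1) * z) = c ^ (m + 1 + 1) * z := by ring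
    rw [e]
    exact ⟨h2.le, h, h4.le⟩

lemma notMem_K_of_mem_cap {c z : ℂ} {n : ℕ} (hc : 1 < ‖c‖) (hβ : 0 < c.im) (hz : z ∈ cap c n) :
    z ∉ K c :=
  notMem_K_of_pow_mul_re_lt hc hβ (fun j hj => (hz.2.1 j hj).le) hz.2.2.1

/-- Where `f` folds, `re_f_f_sub_le` is an equality. -/
lemma re_mul_f_sub_eq {c z : ℂ} (hc : 1 < ‖c‖) (h : (c * z).im ≤ -1) :
    (c * f c z).re - (ell0 c).re = normSq c * (z.re - (ell0 c).re) := by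
  have h1 := normSq_sub_one_mul_ell0_re hc
  rw [f_of_ge h, mul_re, reflectFL_re, reflectFL_im]
  simp only [mul_re, mul_im, normSq_apply] at *
  linarith

lemma ell0_re_lt_vertex_one_re {c : ℂ} (hc : 1 < ‖c‖) (hβ : 0 < c.im) :
    (ell0 c).re < (vertex c 1).re := by
  have hN := one_lt_normSq hc
  have h1 := normSq_pow_mul_vertex (ne_zero_of_im_pos hβ) 1
  have g := congrArg re h1
  rw [pow_one, re_ofReal_mul, mul_re, conj_re, conj_im] at g
  have h2 := mul_ell0_re hc
  rw [mul_re] at h2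
  have hx := ell0_re_neg hc hβ
  have e : normSq c * ((vertex c 1).re - (ell0 c).re) = -(ell0 c).re * normSq (c - 1) := by
    rw [mul_sub, g]
    simp only [normSq_apply, sub_re, sub_im, one_re, one_im]
    linear_combination -h2
  have h3 : 0 < normSq (c - 1) := normSq_pos.2 fun h => by
    have := congrArg im h
    simp at this
    linarith
  have h4 : 0 < normSq c * ((vertex c 1).re - (ell0 c).re) := by
    rw [e]
    exact mul_pos (by linarith) h3
  have := pos_of_mul_pos_right h4 (by linarith)
  linarith

/-- The crossing point is a limit of points of `cap c n`: first move from `ζ` along `L_n` towards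
`ℓ_n`, then slightly outwards. -/
lemma FirstCrossing.mem_closure_cap {c : ℂ} {n : ℕ} (h : FirstCrossing c n) (hc : 1 < ‖c‖)
    (hβ : 0 < c.im) {s : ℝ} (hs0 : 0 < s) (hs1 : s ≤ 1) (hs : (c * edgePoint c n s).im = -1)
    (him : -1 < (edgePoint c n s).im) : edgePoint c n s ∈ closure (cap c n) := by
  have hc0 := ne_zero_of_im_pos hβ
  have hy := neg_one_lt_ell0_im hc hβ
  have hN := one_lt_normSq hc
  obtain ⟨m, rfl⟩ : ∃ m, n = m + 1 := ⟨n - 1, by have := h.pos; omega⟩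
  have hKre : ∀ k ≤ m + 1, (ell0 c).re ≤ (vertex c k).re := fun k hk =>
    ell0_re_le_of_mem_K hc hβ (h.vertex_mem_K hc hβ hk)
  -- moving back along `L_n`
  have along : ∀ r : ℝ, 0 < r → r < s → -1 < (edgePoint c (m + 1) r).im →
      edgePoint c (m + 1) r ∈ closure (cap c (m + 1)) := by
    intro r hr0 hrs hrim
    have hr1 : r < 1 := by linarith
    have c1 : ∀ j < m + 1, -1 < (c ^ (j + 1) * edgePoint c (m + 1) r).im := by
      intro j hj
      have e : c ^ (j + 1) * edgePoint c (m + 1) r = edgePoint c (m - j) r := by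
        rw [← pow_mul_edgePoint_add hc0 (j + 1) (m - j), show m - j + (j + 1) = m + 1 by omega]
      rw [e, edgePoint_im]
      have h1 := h.above (m - j) (by omega)
      rcases j with _ | j
      · rw [mul_edgePoint_succ hc0, edgePoint_im] at hs
        have h2 := h.below
        rw [Nat.sub_zero] at *
        nlinarith
      · have h2 := h.above (m - (j + 1) + 1) (by omega)
        nlinarith
    have c2 : ∀ k ≤ m + 1, (ell0 c).re < (c ^ k * edgePoint c (m + 1) r).re := by
      intro k hk
      rcases k with _ | k
      · have h1 := hKre (m + 1) le_rfl
        have h2 : normSq c * ((edgePoint c (m + 1) s).re - (ell0 c).re) =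
            (c ^ 2 * edgePoint c (m + 1) s).re - (ell0 c).re := by
          rw [← re_mul_f_sub_eq hc hs.le, f_of_le hs.ge, ← mul_assoc, ← sq]
        have h3 : 0 ≤ (edgePoint c (m + 1) s).re - (ell0 c).re ∧
            0 < (vertex c (m + 1)).re - (ell0 c).re +
              ((edgePoint c (m + 1) s).re - (ell0 c).re) := by
          rcases m with _ | m
          · rw [pow_succ_mul_edgePoint_re hc hβ, sub_self] at h2
            have h4 := (mul_eq_zero.1 h2).resolve_left (by linarith)
            rw [h4]
            exact ⟨le_rfl, by linarith [ell0_re_lt_vertex_one_re hc hβ]⟩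
          · have e := pow_mul_edgePoint_add hc0 2 m s
            rw [show m + 1 + 1 = m + 2 by ring] at h1 h2 ⊢
            rw [e, edgePoint_re c m] at h2
            have h4 := hKre m (by omega)
            have h5 := h.ell0_re_lt_vertex_re hc hβ (m := m + 1) (by omega) (by omega)
            have h6 : 0 < normSq c * ((edgePoint c (m + 2) s).re - (ell0 c).re) := by
              rw [h2]
              nlinarith
            have h7 := pos_of_mul_pos_right h6 (by linarith)
            exact ⟨h7.le, by linarith⟩
        rw [pow_zero, one_mul]
        rw [edgePoint_re] at h3 ⊢
        generalize (vertex c (m + 1)).re = p at *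
        generalize (vertex c (m + 1 + 1)).re = q at *
        -- the moved point divides the segment from `ℓ_n` to `ζ` in the ratio `r : s - r`
        have e : s * ((1 - r) * p + r * q - (ell0 c).re) = (s - r) * (p - (ell0 c).re) +
          r * ((1 - s) * p + s * q - (ell0 c).re) := by ring
        have h8 : 0 < s * ((1 - r) * p + r * q - (ell0 c).re) := by
          rw [e]
          rcases h3.1.lt_or_eq with h9 | h9
          · have := mul_pos hr0 h9
            have := mul_nonneg (by linarith : 0 ≤ s - r) (by linarith : 0 ≤ p - (ell0 c).re)
            linarith
          · have := mul_pos (by linarith : 0 < s - r) (by linarith : 0 < p - (ell0 c).re)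
            rw [← h9]
            linarith
        have := pos_of_mul_pos_right h8 hs0.le
        linarith
      · have e : c ^ (k + 1) * edgePoint c (m + 1) r = edgePoint c (m - k) r := by
          rw [← pow_mul_edgePoint_add hc0 (k + 1) (m - k), show m - k + (k + 1) = m + 1 by omega]
        rw [e, edgePoint_re]
        rcases Nat.eq_zero_or_pos (m - k) with h0 | h0
        · have h1 := ell0_re_lt_vertex_one_re hc hβ
          rw [h0, vertex_zero]
          nlinarith
        · have h1 := h.ell0_re_lt_vertex_re hc hβ (m := m - k) h0 (by omega)
          have h2 := hKre (m - k + 1) (by omega)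
          nlinarith
    have c3 := pow_succ_mul_edgePoint_re hc hβ (m + 1) r
    have c4 := pow_succ_mul_edgePoint_im hc hβ (m + 1) r
    -- pushing outwards
    generalize edgePoint c (m + 1) r = y at *
    have hcont : Tendsto (fun τ : ℝ => y - τ / c ^ (m + 1 + 1)) (𝓝[>] 0) (𝓝 y) := by
      have : Continuous fun τ : ℝ => y - τ / c ^ (m + 1 + 1) := by fun_prop
      simpa using (this.tendsto 0).mono_left nhdsWithin_le_nhds
    refine mem_closure_of_tendsto hcont ?_
    have hopen : IsOpen {z : ℂ | -1 < z.im ∧ (∀ j < m + 1, -1 < (c ^ (j + 1) * z).im) ∧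
        ∀ k ≤ m + 1, (ell0 c).re < (c ^ k * z).re} := by
      refine IsOpen.and ?_ (IsOpen.and ?_ ?_)
      · exact isOpen_lt (by fun_prop) (by fun_prop)
      · exact isOpen_forall_lt (n := m + 1) (fun k hk => le_of_lt hk) fun k => by fun_prop
      · exact isOpen_forall_lt (fun k hk => hk) fun k => by fun_prop
    filter_upwards [hcont.eventually (hopen.mem_nhds ⟨hrim, c1, c2⟩),
      self_mem_nhdsWithin] with τ hτ (hτ0 : 0 < τ)
    have e : c ^ (m + 1 + 1) * (y - τ / c ^ (m + 1 + 1)) = c ^ (m + 1 + 1) * y - τ := by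
      field_simp
    refine ⟨hτ.1, hτ.2.1, ?_, ?_, ?_, hτ.2.2⟩
    · rw [e, sub_re, ofReal_re, c3]
      linarith
    · rw [e, sub_im, ofReal_im, c4]
      nlinarith
    · rw [e, sub_im, ofReal_im, c4]
      nlinarith
  have hcont : Tendsto (fun r : ℝ => edgePoint c (m + 1) r) (𝓝[<] s) (𝓝 (edgePoint c (m + 1) s)) := by
    have : Continuous fun r : ℝ => edgePoint c (m + 1) r := by
      unfold edgePoint
      fun_prop
    exact (this.tendsto s).mono_left nhdsWithin_le_nhds
  rw [← closure_closure]
  refine mem_closure_of_tendsto hcont ?_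
  have hopen : IsOpen {z : ℂ | -1 < z.im} := isOpen_lt (by fun_prop) (by fun_prop)
  filter_upwards [hcont.eventually (hopen.mem_nhds him), self_mem_nhdsWithin,
    nhdsWithin_le_nhds (lt_mem_nhds hs0)] with r h1 h2 h3
  exact along r h3 h2 h1

/-! ### `K` is a proper subset of `P` -/

/-- The points `g` of `cap c n` close to `ζ` have a preimage `y` below the pre-folding line which
has a preimage outside `S ∪ S'`. -/
lemma FirstCrossing.K_ssubset_P {c : ℂ} {n : ℕ} (h : FirstCrossing c n) (hc : 1 < ‖c‖)
    (hβ : 0 < c.im) {s : ℝ} (hs : (c * edgePoint c n s).im = -1)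
    (hcl : edgePoint c n s ∈ closure (cap c n)) : K c ⊂ P c := by
  have hc0 := ne_zero_of_im_pos hβ
  have hN := one_lt_normSq hc
  refine (ssubset_iff_of_subset (K_subset_P hc hβ)).2 ?_
  have hopen : IsOpen {g : ℂ | -1 < (reflectFL g / c).im} :=
    isOpen_lt continuous_const (continuous_im.comp (continuous_reflectFL.div_const _))
  have hmem : edgePoint c n s ∈ {g : ℂ | -1 < (reflectFL g / c).im} := by
    generalize edgePoint c n s = ζ at *
    have e : normSq c * (reflectFL ζ / c).im = 1 - 2 * c.re := by
      have e1 : c * (reflectFL ζ / c) = reflectFL ζ := mul_div_cancel₀ _ hc0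
      have e2 := congrArg re e1
      have e3 := congrArg im e1
      rw [mul_re, reflectFL_re] at e2
      rw [mul_im, reflectFL_im] at e3
      rw [mul_im] at hs
      rw [normSq_apply]
      linear_combination c.re * e3 - c.im * e2 - hs
    have e4 : 0 < normSq c * ((reflectFL ζ / c).im + 1) := by
      rw [mul_add, e, normSq_apply]
      nlinarith [mul_pos hβ hβ, sq_nonneg (c.re - 1)]
    have := pos_of_mul_pos_right e4 (by linarith)
    change -1 < (reflectFL ζ / c).im
    linarith
  obtain ⟨g, hg1, hg⟩ := mem_closure_iff.1 hcl _ hopen hmem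
  have hg1 : -1 < (reflectFL g / c).im := hg1
  obtain ⟨y, hy⟩ : ∃ y, y = reflectFL g / c := ⟨_, rfl⟩
  rw [← hy] at hg1
  have hcy : c * y = reflectFL g := by rw [hy, mul_div_cancel₀ _ hc0]
  have hcyim : (c * y).im < -1 := by
    rw [hcy, reflectFL_im]
    linarith [hg.1]
  have hfy : f c y = g := by rw [f_of_ge hcyim.le, hcy, reflectFL_reflectFL]
  have hcyre : (ell0 c).re < (c * y).re := by
    rw [hcy, reflectFL_re]
    simpa using hg.2.2.2.2.2 0 (by omega)
  have hyre : (ell0 c).re < y.re := by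
    have e := re_mul_f_sub_eq hc hcyim.le
    rw [hfy] at e
    have h1 : (ell0 c).re < (c * g).re := by simpa using hg.2.2.2.2.2 1 h.pos
    have h2 : 0 < normSq c * (y.re - (ell0 c).re) := by
      rw [← e]
      linarith
    have := pos_of_mul_pos_right h2 (by linarith)
    linarith
  have hz : c * (y / c) = y := mul_div_cancel₀ _ hc0
  have hz2 : c ^ 2 * (y / c) = c * y := by rw [sq, mul_assoc, hz]
  refine ⟨y / c, fun hint => ?_, ?_⟩
  · exact notMem_of_below_PFL hc hβ (by rwa [hz]) (by rwa [hz2]) (by rwa [hz]) (by rwa [hz2])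
      (interior_subset hint)
  · rw [← f_mem_K_iff, f_of_le (by rw [hz]; exact hg1.le), hz, ← f_mem_K_iff, hfy]
    exact notMem_K_of_mem_cap hc hβ hg

/-! ### The polygon inside the outer-most boundary -/

lemma reflectPFL_convex {c : ℂ} (s : ℝ) (z w : ℂ) :
    reflectPFL c ((1 - s) * z + s * w) = (1 - s) * reflectPFL c z + s * reflectPFL c w := by
  simp only [reflectPFL, reflectFL, map_mul, map_add, map_sub, conj_ofReal, map_one]
  ring

lemma reflectPFL_mem_segment {c z a b : ℂ} (h : z ∈ segment ℝ a b) :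
    reflectPFL c z ∈ segment ℝ (reflectPFL c a) (reflectPFL c b) := by
  rw [segment_eq_image] at h ⊢
  obtain ⟨s, hs, rfl⟩ := h
  refine ⟨s, hs, ?_⟩
  have := reflectPFL_convex (c := c) s a b
  simpa using this.symm

lemma reflectPFL_of_im_eq {c z : ℂ} (hc : c ≠ 0) (h : (c * z).im = -1) : reflectPFL c z = z := by
  rw [reflectPFL, reflectFL_of_im_eq h, mul_div_cancel_left₀ _ hc]

/-- The open polygon with frontier in `outerBoundary`: its intersection with the half plane above the
pre-folding line is cut out by the lines through `L₀, …, L_n`, and the other half is the mirror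
image. Points are folded onto the upper half by `z ↦ f c z / c`. -/
def polygon (c : ℂ) (n : ℕ) : Set ℂ := {z | ∀ k ≤ n, (ell0 c).re < (c ^ k * f c z).re}

lemma isOpen_polygon (c : ℂ) (n : ℕ) : IsOpen (polygon c n) :=
  isOpen_forall_lt (fun _ hk => hk) fun _ =>
    continuous_re.comp (continuous_const.mul (continuous_f c))

/-- The first power of `c` with negative real part has nonnegative imaginary part. -/
lemma FirstCrossing.exists_pow_re_neg {c : ℂ} {n : ℕ} (h : FirstCrossing c n) (hc : 1 < ‖c‖)
    (hβ : 0 < c.im) : ∃ j ≤ n, (c ^ j).re < 0 ∧ 0 ≤ (c ^ j).im := by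
  classical
  have hex : ∃ j, (c ^ j).re < 0 := ⟨n, h.pow_re_neg hc hβ⟩
  refine ⟨Nat.find hex, Nat.find_min' hex (h.pow_re_neg hc hβ), Nat.find_spec hex, ?_⟩
  have hmin : ∀ i < Nat.find hex, 0 ≤ (c ^ i).re := fun i hi => not_lt.1 (Nat.find_min hex hi)
  generalize Nat.find hex = j at *
  induction j with
  | zero => simp
  | succ j ih =>
    rcases le_or_gt 0 c.re with hα | hα
    · rw [pow_succ_im]
      have h1 := ih fun i hi => hmin i (by omega)
      have h2 := hmin j (by omega)
      positivity
    · rcases j with _ | j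
      · simpa using hβ.le
      · have := hmin 1 (by omega)
        rw [pow_one] at this
        linarith

/-- The lines through `L₀, …, L_n` turn by more than a right angle, so that together with the
pre-folding line they bound a bounded region. -/
lemma FirstCrossing.isBounded_polygon {c : ℂ} {n : ℕ} (h : FirstCrossing c n) (hc : 1 < ‖c‖)
    (hβ : 0 < c.im) : Bornology.IsBounded (polygon c n) := by
  obtain ⟨j, hjn, ha, hb⟩ := h.exists_pow_re_neg hc hβ
  obtain ⟨X, hX⟩ : ∃ X, X = (-(ell0 c).re + (c ^ j).im) / -(c ^ j).re := ⟨_, rfl⟩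
  have hx := ell0_re_neg hc hβ
  have hX0 : 0 ≤ X := by rw [hX]; exact div_nonneg (by linarith) (by linarith)
  obtain ⟨A, hA⟩ : ∃ A, A = X - (ell0 c).re := ⟨_, rfl⟩
  obtain ⟨B, hB⟩ : ∃ B, B = (|c.re| * A - (ell0 c).re) / c.im := ⟨_, rfl⟩
  have hB' : B * c.im = |c.re| * A - (ell0 c).re := by rw [hB, div_mul_cancel₀ _ hβ.ne']
  refine isBounded_iff_forall_norm_le.2 ⟨A + (B + 1) + 2, fun z hz => ?_⟩
  have h0 := hz 0 (by omega)
  have h1 := hz 1 h.pos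
  have h2 := hz j hjn
  have h3 := neg_one_le_f_im c z
  rw [pow_zero, one_mul] at h0
  rw [pow_one] at h1
  have hle : ‖c * z‖ ≤ ‖f c z‖ + 2 := by
    rcases le_total (-1) (c * z).im with h | h
    · rw [f_of_le h]
      linarith
    · have : c * z = (starRingEnd ℂ) (f c z) - 2 * I := by
        rw [f_of_ge h]
        exact (reflectFL_reflectFL _).symm
      calc ‖c * z‖ ≤ ‖(starRingEnd ℂ) (f c z)‖ + ‖2 * I‖ := by rw [this]; exact norm_sub_le _ _
        _ = ‖f c z‖ + 2 := by simp
  have hzle : ‖z‖ ≤ ‖c * z‖ := by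
    rw [norm_mul]
    nlinarith [norm_nonneg z]
  have hsum := norm_le_abs_re_add_abs_im (f c z)
  rw [mul_re] at h1 h2
  generalize (f c z).re = x at *
  generalize (f c z).im = y at *
  have hxX : x ≤ X := by
    rw [hX, le_div_iff₀ (by linarith)]
    nlinarith
  have hxA : |x| ≤ A := by rw [abs_le]; constructor <;> linarith
  have hyB : y ≤ B := by
    have e1 : c.re * x ≤ |c.re| * A := by
      calc c.re * x ≤ |c.re * x| := le_abs_self _
        _ = |c.re| * |x| := abs_mul _ _
        _ ≤ |c.re| * A := mul_le_mul_of_nonneg_left hxA (abs_nonneg _)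
    by_contra! hcon
    nlinarith
  have hB0 : 0 ≤ B := by
    rw [hB]
    refine div_nonneg ?_ hβ.le
    have := mul_nonneg (abs_nonneg c.re) (by linarith : 0 ≤ A)
    linarith
  have hyB' : |y| ≤ B + 1 := by rw [abs_le]; constructor <;> linarith
  linarith

/-- A point on the line through `L_k` which satisfies the inequality of the preceding line lies on
`L_k` or beyond `ℓ_{k+1}`. -/
lemma exists_eq_edgePoint {c w : ℂ} {k : ℕ} (hc : 1 < ‖c‖) (hβ : 0 < c.im)
    (him : -1 ≤ w.im) (hk : (c ^ k * w).re = (ell0 c).re)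
    (hprev : ∀ j, k = j + 1 → (ell0 c).re ≤ (c ^ j * w).re) :
    ∃ r : ℝ, 0 ≤ r ∧ w / c = edgePoint c k r ∧
      (c ^ k * w).im = -2 - (ell0 c).im + 2 * r * ((ell0 c).im + 1) := by
  have hc0 := ne_zero_of_im_pos hβ
  have hy := neg_one_lt_ell0_im hc hβ
  have hx1 := mul_ell0_re hc
  have hx2 := normSq_sub_one_mul_ell0_re hc
  have hlow : -2 - (ell0 c).im ≤ (c ^ k * w).im := by
    rcases k with _ | j
    · rw [pow_zero, one_mul]
      linarith
    · have h1 := hprev j rfl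
      rw [pow_succ', mul_assoc] at hk ⊢
      generalize c ^ j * w = u at *
      have h2 := mul_le_mul_of_nonneg_left h1 (normSq_nonneg c)
      rw [mul_re] at hx1 hk
      rw [mul_im]
      rw [normSq_apply] at hx2 h2
      by_contra! hcon
      have h3 := mul_pos hβ (sub_pos.2 hcon)
      have h4 : (c.re * c.re + c.im * c.im) * u.re =
          c.re * (ell0 c).re + c.im * (c.re * u.im + c.im * u.re) := by
        linear_combination c.re * hk
      linarith
  obtain ⟨r, hr⟩ : ∃ r, r = ((c ^ k * w).im + 2 + (ell0 c).im) / (2 * ((ell0 c).im + 1)) :=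
    ⟨_, rfl⟩
  have hr' : r * (2 * ((ell0 c).im + 1)) = (c ^ k * w).im + 2 + (ell0 c).im := by
    rw [hr, div_mul_cancel₀ _ (by linarith)]
  have e : (c ^ k * w).im = -2 - (ell0 c).im + 2 * r * ((ell0 c).im + 1) := by linarith
  refine ⟨r, by rw [hr]; exact div_nonneg (by linarith) (by linarith), ?_, e⟩
  apply mul_left_cancel₀ (pow_ne_zero (k + 1) hc0)
  have e1 : c ^ (k + 1) * (w / c) = c ^ k * w := by
    rw [pow_succ]
    field_simp
  rw [e1]
  apply Complex.ext
  · rw [hk, pow_succ_mul_edgePoint_re hc hβ]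
  · rw [e, pow_succ_mul_edgePoint_im hc hβ]

lemma mem_outerBoundary_of_mem_L {c z ζ : ℂ} {n k : ℕ} (hk : k < n) (h : z ∈ L c k) :
    z ∈ outerBoundary c n ζ := by
  refine Or.inr (mem_iUnion₂.2 ⟨k, ?_, h⟩)
  rw [mem_ofPred_eq, abs_of_nonneg (by positivity)]
  omega

lemma reflectPFL_mem_outerBoundary_of_mem_L {c z ζ : ℂ} {n k : ℕ} (hc : 1 < ‖c‖) (hβ : 0 < c.im)
    (hk : k < n) (h : z ∈ L c k) : reflectPFL c z ∈ outerBoundary c n ζ := by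
  refine Or.inr (mem_iUnion₂.2 ⟨-k, ?_, ?_⟩)
  · rw [mem_ofPred_eq, abs_neg, abs_of_nonneg (by positivity)]
    omega
  · rw [L_natCast] at h
    have h1 := reflectPFL_mem_segment (c := c) h
    rw [← ell_one_sub hc hβ, ← ell_one_sub hc hβ, segment_symm] at h1
    have e1 : (1 : ℤ) - ((k + 1 : ℕ) : ℤ) = -k := by push_cast; ring
    have e2 : (1 : ℤ) - k = -k + 1 := by ring
    rwa [e1, e2] at h1

lemma FirstCrossing.closure_polygon_subset {c : ℂ} {n : ℕ} (h : FirstCrossing c n) (hc : 1 < ‖c‖)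
    (hβ : 0 < c.im) {s : ℝ} (hs0 : 0 < s) (hs : (c * edgePoint c n s).im = -1) :
    closure (polygon c n) ⊆ polygon c n ∪ outerBoundary c n (edgePoint c n s) := by
  have hc0 := ne_zero_of_im_pos hβ
  have hy := neg_one_lt_ell0_im hc hβ
  intro z hz
  by_cases hzp : z ∈ polygon c n
  · exact Or.inl hzp
  right
  have hle : ∀ k ≤ n, (ell0 c).re ≤ (c ^ k * f c z).re := by
    intro k hk
    have hcl : IsClosed {z : ℂ | (ell0 c).re ≤ (c ^ k * f c z).re} :=
      isClosed_le continuous_const (continuous_re.comp (continuous_const.mul (continuous_f c)))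
    exact closure_minimal (fun w hw => (hw k hk).le) hcl hz
  obtain ⟨k, hkn, hk⟩ : ∃ k ≤ n, (c ^ k * f c z).re = (ell0 c).re := by
    by_contra! hcon
    exact hzp fun k hk => (hle k hk).lt_of_ne (hcon k hk).symm
  have him := neg_one_le_f_im c z
  -- `z` or its mirror image is `f c z / c`
  have hfold : z = f c z / c ∨ z = reflectPFL c (f c z / c) := by
    rcases le_total (-1) (c * z).im with h | h
    · left
      rw [f_of_le h, mul_div_cancel_left₀ _ hc0]
    · right
      rw [f_of_ge h, ← mul_reflectPFL hc0, mul_div_cancel_left₀ _ hc0, reflectPFL_reflectPFL hc0]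
  obtain ⟨r, hr0, hr, hrim⟩ := exists_eq_edgePoint hc hβ him hk
    fun j hj => hle j (by omega)
  rcases hkn.lt_or_eq with hkn | rfl
  · have hr1 : r ≤ 1 := by
      have h1 := hle (k + 1) (by omega)
      have h2 := mul_ell0_re hc
      rw [pow_succ', mul_assoc, mul_re, hk, hrim] at h1
      rw [mul_re] at h2
      by_contra! hcon
      nlinarith [mul_pos hβ (mul_pos (sub_pos.2 hcon) (by linarith : 0 < (ell0 c).im + 1))]
    have hL : f c z / c ∈ L c k := by
      rw [L_natCast, mem_segment_vertex_iff]
      exact ⟨r, hr0, hr1, hr⟩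
    rcases hfold with e | e
    · rw [e]
      exact mem_outerBoundary_of_mem_L hkn hL
    · rw [e]
      exact reflectPFL_mem_outerBoundary_of_mem_L hc hβ hkn hL
  · have hseg : f c z / c ∈ segment ℝ (ell c k) (edgePoint c k s) := by
      have hrs : r ≤ s := by
        obtain ⟨m, rfl⟩ : ∃ m, k = m + 1 := ⟨k - 1, by have := h.pos; omega⟩
        have h1 := h.above m (by omega)
        have h2 := h.below
        have e : f c z = edgePoint c m r := by
          rw [← mul_edgePoint_succ hc0, ← hr, mul_div_cancel₀ _ hc0]
        rw [e, edgePoint_im] at him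
        rw [mul_edgePoint_succ hc0, edgePoint_im] at hs
        by_contra! hcon
        nlinarith
      rw [hr, ell_natCast, segment_eq_image]
      refine ⟨r / s, ⟨by positivity, (div_le_one hs0).2 hrs⟩, ?_⟩
      have hs' : (s : ℂ) ≠ 0 := ofReal_ne_zero.2 hs0.ne'
      simp only [edgePoint, real_smul]
      push_cast
      field_simp
      ring
    rcases hfold with e | e
    · rw [e]
      exact Or.inl (Or.inl hseg)
    · rw [e]
      refine Or.inl (Or.inr ?_)
      have h1 := reflectPFL_mem_segment (c := c) hseg
      rwa [reflectPFL_of_im_eq hc0 hs, ell_natCast, ← ell_one_sub hc hβ,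
        show (1 : ℤ) - k = -(k - 1) by ring] at h1

lemma FirstCrossing.polygon_subset {c : ℂ} {n : ℕ} (h : FirstCrossing c n) (hc : 1 < ‖c‖)
    (hβ : 0 < c.im) {s : ℝ} (hs0 : 0 < s) (hs : (c * edgePoint c n s).im = -1) :
    polygon c n ⊆ regionBoundedBy (outerBoundary c n (edgePoint c n s)) := by
  intro z hz
  by_cases hΓ : z ∈ outerBoundary c n (edgePoint c n s)
  · exact Or.inl hΓ
  refine Or.inr ⟨hΓ, (h.isBounded_polygon hc hβ).subset ?_⟩
  refine isPreconnected_connectedComponentIn.subset_left_of_subset_union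
    (v := (closure (polygon c n))ᶜ) (isOpen_polygon c n) isClosed_closure.isOpen_compl ?_ ?_ ?_
  · exact disjoint_left.2 fun w hw hw' => hw' (subset_closure hw)
  · intro w hw
    by_contra hcon
    rw [mem_union, not_or, mem_compl_iff, not_not] at hcon
    exact connectedComponentIn_subset _ _ hw
      ((h.closure_polygon_subset hc hβ hs0 hs hcon.2).resolve_left hcon.1)
  · exact ⟨z, mem_connectedComponentIn hΓ, hz⟩

/-- The points of `cap c n`, divided by `c`, are inside the polygon and in the interior of `S`. -/
lemma FirstCrossing.P_ne_regionBoundedBy {c : ℂ} {n : ℕ} (h : FirstCrossing c n) (hc : 1 < ‖c‖)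
    (hβ : 0 < c.im) {s : ℝ} (hs0 : 0 < s) (hs : (c * edgePoint c n s).im = -1)
    (hne : (cap c n).Nonempty) :
    P c ≠ regionBoundedBy (outerBoundary c n (edgePoint c n s)) := by
  have hc0 := ne_zero_of_im_pos hβ
  obtain ⟨g, hg⟩ := hne
  have hcg : c * (g / c) = g := mul_div_cancel₀ _ hc0
  intro hP
  have hmem : g / c ∈ P c := by
    rw [hP]
    refine h.polygon_subset hc hβ hs0 hs fun k hk => ?_
    rw [f_of_le (by rw [hcg]; exact hg.1.le), hcg]
    exact hg.2.2.2.2.2 k hk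
  refine hmem (interior_maximal (t := (fun z => c * z) ⁻¹' cap c n) (fun z hz => Or.inl ?_)
    ((isOpen_cap c n).preimage (by fun_prop)) (by rwa [mem_preimage, hcg]))
  have hz : c * z ∈ cap c n := hz
  obtain ⟨k, hk⟩ := mem_iUnion.1 (cap_subset_S hc hβ h.pos hz)
  refine mem_iUnion.2 ⟨k + 1, ⟨c * z, hk, by field_simp⟩, mem_PHPlus_iff.2 hz.1.le⟩

end TwistedTent

theorem mainTheorem2 (c : ℂ) (hc : 1 < ‖c‖) (hβ : 0 < c.im) (n : ℤ) (ζ : ℂ)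
    (hζ : TwistedTent.IsZeta c n ζ) (him : -1 < ζ.im) :
    TwistedTent.gamma0 c ∉ TwistedTent.K c ∧
      TwistedTent.P c ≠ TwistedTent.regionBoundedBy (TwistedTent.outerBoundary c n ζ) ∧
      TwistedTent.K c ⊂ TwistedTent.P c := by
  obtain ⟨m, rfl, h, s, hs0, hs1, rfl, hs⟩ := hζ.firstCrossing hc hβ
  have hcl := h.mem_closure_cap hc hβ hs0 hs1 hs him
  exact ⟨h.gamma0_notMem_K hc hβ hs him,
    h.P_ne_regionBoundedBy hc hβ hs0 hs (closure_nonempty_iff.1 ⟨_, hcl⟩),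
    h.K_ssubset_P hc hβ hs hcl⟩
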